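/- Let $H$ be a separable real Hilbert space and let $X$ be an $H$-valued random variable such that (A1) for every $h\in H$ there is $h'\in H$ with $\langle h,h'\rangle=0$ and $\operatorname{Var}(\langle h',X\rangle)>0$ (the variance may be infinite: $\langle h',X\rangle$ is not almost surely constant); (A2) there is a constant $K>0$ with $\mathbb{E}\big[\|X-h\|^{-1}\big]\le K$ for all $h\in H$; (A3) there is a constant $K>0$ with $\mathbb{E}\big[\|X-h\|^{-2}\big]\le K$ for all $h\in H$. Let $m=\arg\min_{h\in H}\mathbb{E}\big[\|X-h\|-\|X\|\big]$ be the geometric median of $X$, let $X_1,X_2,\dots$ be i.i.d. copies of $X$, let $c_\gamma>0$ and $\alpha\in(1/2,1)$, and put $\gamma_n=c_\gamma n^{-\alpha}$. Let $Z_1$ be an almost surely bounded $H$-valued random variable that is independent of $(X_2,X_3,\dots)$ (for example, a bounded measurable function of $X_1$), and define, for $n\ge1$, $$Z_{n+1}=Z_n+\gamma_n\,\frac{X_{n+1}-Z_n}{\|X_{n+1}-Z_n\|},$$ where the fraction is read as $0$ if $X_{n+1}=Z_n$. Then there is a constant $C>0$ such that for every $\delta\in(0,1)$ there is a rank $n_\delta\in\mathbb{N}$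 such that for all $n\ge n_\delta$, $$\mathbb{P}\Big[\|Z_n-m\|\le \frac{C}{n^{\alpha/2}}\ln\Big(\frac{4}{\delta}\Big)\Big]\ge 1-\delta .$$ -/

import Mathlib

open MeasureTheory ProbabilityTheory

noncomputable section

namespace GeometricMedian

variable {Ω H : Type*} [MeasurableSpace Ω]
  [NormedAddCommGroup H] [InnerProductSpace ℝ H]

/-- `X` is not concentrated on a straight line: for every `h` there is `h'` orthogonal to `h` with
`Var ⟨h', X⟩ > 0`. No moment of `X` is assumed, so the variance takes values in `[0, ∞]`; for a
measurable variable it vanishes exactly when the variable is almost surely constant. -/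
def NotOnLine (X : Ω → H) (P : Measure Ω) : Prop :=
  ∀ h : H, ∃ h' : H, inner ℝ h h' = 0 ∧ 0 < evariance (fun ω => inner ℝ h' (X ω)) P

/-- `E[‖X - h‖ ^ (-p)] ≤ C` for all `h`, with one finite positive constant `C`. The expectation is
the integral of a `[0, ∞]`-valued function, and `0 ^ (-p) = ∞` for `p > 0`. -/
def BoundedInverseMoment (p : ℕ) (X : Ω → H) (P : Measure Ω) : Prop :=
  ∃ C : ℝ, 0 < C ∧ ∀ h : H, ∫⁻ ω, (‖X ω - h‖ₑ ^ p)⁻¹ ∂P ≤ ENNReal.ofReal C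

/-- The objective `G(h) = E[‖X - h‖ - ‖X‖]`; the integrand is bounded by `‖h‖`. -/
def objective (X : Ω → H) (P : Measure Ω) (h : H) : ℝ :=
  ∫ ω, (‖X ω - h‖ - ‖X ω‖) ∂P

/-- `m` is a geometric median of `X`: a global minimizer of the objective. -/
def IsMedian (X : Ω → H) (P : Measure Ω) (m : H) : Prop :=
  ∀ h : H, objective X P m ≤ objective X P h

/-- The Robbins-Monro sequence started at `Z₁`:
`Z_{n+1} = Z_n + γ_n (X_{n+1} - Z_n) / ‖X_{n+1} - Z_n‖` for `n ≥ 1`.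
The step is `0` where `X_{n+1} = Z_n`. Indices start at `1`; the value at `0` plays no role, and
`Xs 0` is not used. -/
def robbinsMonro (γ : ℕ → ℝ) (Xs : ℕ → Ω → H) (Z₁ : Ω → H) : ℕ → Ω → H
  | 0 => Z₁
  | 1 => Z₁
  | n + 2 => fun ω =>
      robbinsMonro γ Xs Z₁ (n + 1) ω +
        γ (n + 1) • (‖Xs (n + 2) ω - robbinsMonro γ Xs Z₁ (n + 1) ω‖⁻¹ •
          (Xs (n + 2) ω - robbinsMonro γ Xs Z₁ (n + 1) ω))

end GeometricMedian

end

/-! The objective grows around its minimizer: `objective z - objective m` is at least `l * min r (r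
^ 2)` with `r = ‖z - m‖` (`exists_growth`). The unit sphere of `H` need not be compact, so
positivity in each direction would not give a uniform constant. Instead, the midpoint convexity gap
in direction `e` is bounded below by a mean Gram determinant, and `gram_le` compares this with the
mean Gram determinant of two independent copies of `X - m`, which does not involve `e`.

The step direction is a subgradient, so the squared distance to `m` changes by at most `-2γ(‖X - Z‖
- ‖X - m‖) + γ²`. Averaging over the fresh sample turns the middle term into a drift towards `m`.
Since `∑ γ = ∞`, the sequence comes close to `m` in mean at arbitrarily late times; since `∑ γ² <
∞`, after a late such time it stays in the unit ball with probability at least `1 - ε`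
(`exists_local_events`).

In the unit ball the drift is quadratic, and `E exp(s n^α ‖Z_n - m‖²)`, restricted to these events,
contracts to a universal bound (`exp_moment_step`). Markov's inequality then gives the confidence
ball. The constant depends on `s` alone, hence on the step constant and on `l`; `δ` enters only
through the rank after which these estimates hold. -/

namespace GeometricMedian

/-! ### Growth of the objective around the median -/

section Analysis

variable {H : Type*} [NormedAddCommGroup H] [InnerProductSpace ℝ H]

/-- The Gram determinant of two vectors. -/
def gram (x y : H) : ℝ := ‖x‖ ^ 2 * ‖y‖ ^ 2 - (inner ℝ x y) ^ 2

lemma gram_nonneg (x y : H) : 0 ≤ gram x y := by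
  have h := abs_real_inner_le_norm x y
  have h2 : (inner ℝ x y) ^ 2 ≤ (‖x‖ * ‖y‖) ^ 2 := by
    rw [← sq_abs]; gcongr
  unfold gram; nlinarith

lemma gram_sub_left (x y : H) : gram (x - y) y = gram x y := by
  unfold gram
  rw [inner_sub_left, norm_sub_sq_real, real_inner_self_eq_norm_sq]
  ring

lemma gram_smul_right (x y : H) (a : ℝ) : gram x (a • y) = a ^ 2 * gram x y := by
  unfold gram
  rw [inner_smul_right, norm_smul, mul_pow, Real.norm_eq_abs, sq_abs]
  ring

/-- Two vectors that are both nearly parallel to `e` are nearly parallel to each other. With `u`,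
`v` the components orthogonal to `e`, `gram x e = ‖u‖ ^ 2` and `gram y e = ‖v‖ ^ 2`. This is what
removes the direction `e` from the growth constant. -/
lemma gram_le (x y e : H) (he : ‖e‖ = 1) :
    gram x y ≤ 2 * (‖x‖ ^ 2 * gram y e + ‖y‖ ^ 2 * gram x e) := by
  have hee : inner ℝ e e = 1 := by rw [real_inner_self_eq_norm_sq, he]; norm_num
  obtain ⟨s, hs⟩ : ∃ s : ℝ, s = inner ℝ x e := ⟨_, rfl⟩
  obtain ⟨t, ht⟩ : ∃ t : ℝ, t = inner ℝ y e := ⟨_, rfl⟩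
  obtain ⟨u, hu⟩ : ∃ u : H, u = x - s • e := ⟨_, rfl⟩
  obtain ⟨v, hv⟩ : ∃ v : H, v = y - t • e := ⟨_, rfl⟩
  have hue : inner ℝ u e = 0 := by
    rw [hu, inner_sub_left, real_inner_smul_left, hee, hs]; ring
  have hve : inner ℝ v e = 0 := by
    rw [hv, inner_sub_left, real_inner_smul_left, hee, ht]; ring
  have hx : x = u + s • e := by rw [hu]; abel
  have hy : y = v + t • e := by rw [hv]; abel
  have hnx : ‖x‖ ^ 2 = ‖u‖ ^ 2 + s ^ 2 := by
    rw [hx, norm_add_sq_real, inner_smul_right, hue, norm_smul, he, Real.norm_eq_abs, mul_one,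
      sq_abs]; ring
  have hny : ‖y‖ ^ 2 = ‖v‖ ^ 2 + t ^ 2 := by
    rw [hy, norm_add_sq_real, inner_smul_right, hve, norm_smul, he, Real.norm_eq_abs, mul_one,
      sq_abs]; ring
  have hxy : inner ℝ x y = inner ℝ u v + s * t := by
    rw [hx, hy, inner_add_left, inner_add_right, inner_add_right, inner_smul_right,
      real_inner_smul_left, real_inner_smul_left, inner_smul_right, hue, hee,
      real_inner_comm v e, hve]; ring
  have key := abs_real_inner_le_norm u v
  have h2 : (inner ℝ u v) ^ 2 ≤ (‖u‖ * ‖v‖) ^ 2 := by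
    rw [← sq_abs]; gcongr
  have h3 : -(2 * (s * t) * inner ℝ u v) ≤ s ^ 2 * ‖v‖ ^ 2 + t ^ 2 * ‖u‖ ^ 2 := by
    have : |s * t * inner ℝ u v| ≤ |s * t| * (‖u‖ * ‖v‖) := by
      rw [abs_mul]; gcongr
    have h4 := neg_abs_le (s * t * inner ℝ u v)
    rw [abs_mul s t] at this
    nlinarith [sq_nonneg (|s| * ‖v‖ - |t| * ‖u‖), sq_abs s, sq_abs t]
  unfold gram
  rw [← hs, ← ht, hnx, hny, hxy, he]
  nlinarith [sq_nonneg (inner ℝ u v), mul_nonneg (sq_nonneg ‖u‖) (sq_nonneg ‖v‖)]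

/-- A quantitative form of the strict convexity of the norm along non-parallel directions. -/
lemma gram_le_midpoint_gap (p q : H) {R : ℝ} (hR : 0 < R) (hp : ‖p‖ ≤ R) (hq : ‖q‖ ≤ R) :
    gram p q / (3 * R ^ 3) ≤ (‖p + q‖ + ‖p - q‖) / 2 - ‖p‖ := by
  have e1 := norm_add_sq_real p q
  have e2 := norm_sub_sq_real p q
  have hW := gram_nonneg p q
  have t1 := norm_add_le p q
  have t2 := norm_sub_le p q
  have t3 : 2 * ‖p‖ ≤ ‖p + q‖ + ‖p - q‖ := by
    have := norm_add_le (p + q) (p - q)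
    have e : p + q + (p - q) = (2 : ℝ) • p := by rw [two_smul]; abel
    rw [e, norm_smul] at this
    simpa using this
  have hWdef : gram p q = ‖p‖ ^ 2 * ‖q‖ ^ 2 - (inner ℝ p q) ^ 2 := rfl
  generalize gram p q = W at *
  have a0 := norm_nonneg (p + q)
  have b0 := norm_nonneg (p - q)
  have p0 := norm_nonneg p
  have q0 := norm_nonneg q
  generalize ‖p + q‖ = a at *
  generalize ‖p - q‖ = b at *
  generalize (inner ℝ p q : ℝ) = c at *
  generalize ‖p‖ = n at *
  generalize ‖q‖ = k at *
  -- The Gram determinant measures the excess of `a * b` over `n ^ 2 - k ^ 2`, and `(a + b) ^ 2 - 4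
  -- * n ^ 2` is twice this excess. Both differences of squares are then factored.
  have hab : (a * b) ^ 2 = (n ^ 2 - k ^ 2) ^ 2 + 4 * W := by
    rw [mul_pow, e1, e2, hWdef]; ring
  have hab0 : 0 ≤ a * b := mul_nonneg a0 b0
  have hge : n ^ 2 - k ^ 2 ≤ a * b := le_of_abs_le (abs_le_of_sq_le_sq (by linarith) hab0)
  have hle : a * b + (n ^ 2 - k ^ 2) ≤ 2 * R ^ 2 := by
    have : a * b ≤ n ^ 2 + k ^ 2 := by nlinarith [sq_nonneg (a - b)]
    nlinarith
  have h4W : 4 * W ≤ (a * b - (n ^ 2 - k ^ 2)) * (2 * R ^ 2) := by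
    have : 4 * W = (a * b - (n ^ 2 - k ^ 2)) * (a * b + (n ^ 2 - k ^ 2)) := by nlinarith
    rw [this]
    exact mul_le_mul_of_nonneg_left hle (by linarith)
  have hS : (a + b - 2 * n) * (a + b + 2 * n) = 2 * (a * b - (n ^ 2 - k ^ 2)) := by nlinarith
  have hS2 : (a + b - 2 * n) * (a + b + 2 * n) ≤ (a + b - 2 * n) * (6 * R) :=
    mul_le_mul_of_nonneg_left (by linarith) (by linarith)
  have : 4 * W ≤ (a + b - 2 * n) * (6 * R) * R ^ 2 := by
    calc 4 * W ≤ 2 * (a * b - (n ^ 2 - k ^ 2)) * R ^ 2 := by linarith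
      _ = (a + b - 2 * n) * (a + b + 2 * n) * R ^ 2 := by rw [hS]
      _ ≤ _ := by gcongr
  rw [div_le_iff₀ (by positivity)]
  nlinarith

/-- The midpoint gap, centred at the middle of the segment from `m` to `m + d`: `p = x - m - q` with
`q = d / 2`. Moving `p` along `q` does not change its Gram determinant with `q`, so the bound
depends on `x - m` and `e` only. -/
lemma norm_smul_gap (x m d : H) {R : ℝ} (hR : ‖x - m‖ + 1 = R) (e : H) (r : ℝ)
    (hr0 : 0 ≤ r) (hr : r ≤ 1) (he : ‖e‖ = 1) (hd : d = r • e) :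
    r ^ 2 / 12 * (gram (x - m) e / R ^ 3) ≤
      (‖x - (m + d)‖ + ‖x - m‖) / 2 - ‖x - (m + (1 / 2 : ℝ) • d)‖ := by
  have hx0 := norm_nonneg (x - m)
  have hR0 : 0 < R := by linarith
  set q : H := (r / 2) • e with hq
  have hqd : (1 / 2 : ℝ) • d = q := by rw [hd, hq, smul_smul]; congr 1; ring
  have hd2 : d = q + q := by rw [← hqd, ← add_smul]; norm_num
  have hnq : ‖q‖ = r / 2 := by
    rw [hq, norm_smul, he, Real.norm_eq_abs, abs_of_nonneg (by linarith), mul_one]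
  have hp : ‖x - m - q‖ ≤ R := (norm_sub_le _ _).trans (by linarith)
  have key := gram_le_midpoint_gap (x - m - q) q hR0 hp (by linarith)
  rw [gram_sub_left, hq, gram_smul_right, ← hq] at key
  have e1 : x - m - q + q = x - m := by abel
  have e2 : x - m - q - q = x - (m + d) := by rw [hd2]; abel
  have e3 : x - m - q = x - (m + (1 / 2 : ℝ) • d) := by rw [hqd]; abel
  rw [e1, e2, e3] at key
  calc _ = (r / 2) ^ 2 * gram (x - m) e / (3 * R ^ 3) := by field_simp; ring
    _ ≤ _ := by linarith

lemma gram_div_le_one (x e : H) (he : ‖e‖ = 1) : gram x e / (‖x‖ + 1) ^ 3 ≤ 1 := by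
  have hx := norm_nonneg x
  rw [div_le_one (by positivity)]
  unfold gram
  rw [he]
  nlinarith [sq_nonneg (inner ℝ x e), pow_nonneg hx 3]

/-- The weights `(‖x‖ + 1) ^ 3` are those of the midpoint gap; they also dominate `‖x‖ ^ 2`, so
everything stays bounded and no moment is needed. -/
lemma gram_div_div_le (x y e : H) (he : ‖e‖ = 1) :
    gram x y / ((‖x‖ + 1) ^ 3 * (‖y‖ + 1) ^ 3) ≤
      2 * (gram x e / (‖x‖ + 1) ^ 3 + gram y e / (‖y‖ + 1) ^ 3) := by
  have hx := norm_nonneg x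
  have hy := norm_nonneg y
  have h1 := gram_le x y e he
  have gx := gram_nonneg x e
  have gy := gram_nonneg y e
  have h2 : ‖x‖ ^ 2 ≤ (‖x‖ + 1) ^ 3 := by nlinarith [pow_nonneg hx 3]
  have h3 : ‖y‖ ^ 2 ≤ (‖y‖ + 1) ^ 3 := by nlinarith [pow_nonneg hy 3]
  have e1 : 2 * (gram x e / (‖x‖ + 1) ^ 3 + gram y e / (‖y‖ + 1) ^ 3) =
      2 * ((‖x‖ + 1) ^ 3 * gram y e + (‖y‖ + 1) ^ 3 * gram x e) /
        ((‖x‖ + 1) ^ 3 * (‖y‖ + 1) ^ 3) := by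
    field_simp; ring
  rw [e1]
  gcongr
  refine h1.trans ?_
  gcongr

lemma gram_eq_zero_of_inner {y x h' : H} (hy : y ≠ 0) (h0 : gram y x = 0)
    (hh : inner ℝ y h' = 0) : inner ℝ h' x = 0 := by
  have hyy : ‖y‖ ^ 2 ≠ 0 := by simpa using hy
  set a := inner ℝ y x / ‖y‖ ^ 2
  have hz : ‖x - a • y‖ ^ 2 = 0 := by
    rw [norm_sub_sq_real, inner_smul_right, norm_smul, real_inner_comm, mul_pow, Real.norm_eq_abs,
      sq_abs]
    unfold gram at h0
    simp only [a]
    field_simp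
    linarith
  have hx : x = a • y := by
    have := pow_eq_zero_iff (two_ne_zero) |>.1 hz
    exact sub_eq_zero.1 (norm_eq_zero.1 this)
  rw [hx, inner_smul_right, real_inner_comm, hh, mul_zero]

variable [MeasurableSpace H] [BorelSpace H] [TopologicalSpace.SeparableSpace H]

lemma measurable_gram_prod (m : H) : Measurable (fun z : H × H =>
    gram (z.1 - m) (z.2 - m) / ((‖z.1 - m‖ + 1) ^ 3 * (‖z.2 - m‖ + 1) ^ 3)) := by
  have : SecondCountableTopology H := UniformSpace.secondCountable_of_separable H
  unfold gram
  fun_prop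

/-- If `μ` is not carried by a line, the mean Gram determinant is positive. -/
lemma integral_gram_pos (μ : Measure H) [IsProbabilityMeasure μ] (m : H)
    (hline : ∀ h : H, ∃ h' : H, inner ℝ h h' = 0 ∧ ∀ a : ℝ, ¬ ∀ᵐ x ∂μ, inner ℝ h' x = a) :
    (Integrable (fun z : H × H =>
      gram (z.1 - m) (z.2 - m) / ((‖z.1 - m‖ + 1) ^ 3 * (‖z.2 - m‖ + 1) ^ 3)) (μ.prod μ)) ∧
    0 < ∫ z : H × H,
      gram (z.1 - m) (z.2 - m) / ((‖z.1 - m‖ + 1) ^ 3 * (‖z.2 - m‖ + 1) ^ 3) ∂(μ.prod μ) := by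
  have : SecondCountableTopology H := UniformSpace.secondCountable_of_separable H
  have hnn : ∀ z : H × H,
      0 ≤ gram (z.1 - m) (z.2 - m) / ((‖z.1 - m‖ + 1) ^ 3 * (‖z.2 - m‖ + 1) ^ 3) := fun z =>
    div_nonneg (gram_nonneg _ _) (by positivity)
  have hint : Integrable (fun z : H × H =>
      gram (z.1 - m) (z.2 - m) / ((‖z.1 - m‖ + 1) ^ 3 * (‖z.2 - m‖ + 1) ^ 3)) (μ.prod μ) := by
    refine Integrable.of_bound (measurable_gram_prod m).aestronglyMeasurable 1 (ae_of_all _ ?_)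
    intro z
    rw [Real.norm_eq_abs, abs_of_nonneg (hnn z), div_le_one (by positivity)]
    have h1 := norm_nonneg (z.1 - m)
    have h2 := norm_nonneg (z.2 - m)
    unfold gram
    have h3 : ‖z.1 - m‖ ^ 2 ≤ (‖z.1 - m‖ + 1) ^ 3 := by nlinarith [pow_nonneg h1 3]
    have h4 : ‖z.2 - m‖ ^ 2 ≤ (‖z.2 - m‖ + 1) ^ 3 := by nlinarith [pow_nonneg h2 3]
    have := mul_le_mul h3 h4 (by positivity) (by positivity)
    nlinarith [sq_nonneg (inner ℝ (z.1 - m) (z.2 - m))]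
  refine ⟨hint, lt_of_le_of_ne (integral_nonneg hnn) fun h0 => ?_⟩
  have hz := (integral_eq_zero_iff_of_nonneg hnn hint).1 h0.symm
  have hz2 := Measure.ae_ae_of_ae_prod hz
  have hz3 : ∀ᵐ x ∂μ, ∀ᵐ y ∂μ, gram (x - m) (y - m) = 0 := by
    filter_upwards [hz2] with x hx
    filter_upwards [hx] with y hy
    have hpos : (0 : ℝ) < (‖x - m‖ + 1) ^ 3 * (‖y - m‖ + 1) ^ 3 := by positivity
    simpa [hpos.ne'] using (div_eq_zero_iff.1 hy).resolve_right hpos.ne'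
  have hconst : ∀ h : H, ¬ ∀ h' : H, inner ℝ h h' = 0 → ∀ᵐ x ∂μ, inner ℝ h' (x - m) = 0 := by
    intro h hh
    obtain ⟨h', hor, hne⟩ := hline h
    refine hne (inner ℝ h' m) ?_
    filter_upwards [hh h' hor] with x hx
    rw [inner_sub_right] at hx
    linarith
  -- A vanishing mean puts `μ` on the line through `m` and some `x ≠ m`, or else makes it the point
  -- mass at `m`. Both contradict `hline`, applied to `x - m` and to `0`.
  by_cases hex : ∃ x, (∀ᵐ y ∂μ, gram (x - m) (y - m) = 0) ∧ x - m ≠ 0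
  · obtain ⟨x, hx, hxm⟩ := hex
    refine hconst (x - m) fun h' hor => ?_
    filter_upwards [hx] with y hy
    exact gram_eq_zero_of_inner hxm hy hor
  · push Not at hex
    refine hconst 0 fun h' _ => ?_
    filter_upwards [hz3] with x hx
    rw [hex x hx, inner_zero_right]

omit [InnerProductSpace ℝ H] in
lemma integrable_norm_sub_sub (μ : Measure H) [IsProbabilityMeasure μ] (h k : H) :
    Integrable (fun x => ‖x - h‖ - ‖x - k‖) μ := by
  refine Integrable.of_bound (by fun_prop) ‖h - k‖ (ae_of_all _ fun x => ?_)
  have := abs_norm_sub_norm_le (x - h) (x - k)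
  rw [Real.norm_eq_abs]
  refine this.trans_eq ?_
  rw [← norm_neg]; congr 1; abel

/-- The objective grows at least like `min ‖z - m‖ ‖z - m‖ ^ 2` around its minimizer. -/
theorem exists_growth (μ : Measure H) [IsProbabilityMeasure μ] (m : H)
    (hline : ∀ h : H, ∃ h' : H, inner ℝ h h' = 0 ∧ ∀ a : ℝ, ¬ ∀ᵐ x ∂μ, inner ℝ h' x = a)
    (hm : ∀ h : H, 0 ≤ ∫ x, (‖x - h‖ - ‖x - m‖) ∂μ) :
    ∃ l : ℝ, 0 < l ∧ ∀ z : H,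
      l * min ‖z - m‖ (‖z - m‖ ^ 2) ≤ ∫ x, (‖x - z‖ - ‖x - m‖) ∂μ := by
  have : SecondCountableTopology H := UniformSpace.secondCountable_of_separable H
  obtain ⟨hint, hpos⟩ := integral_gram_pos μ m hline
  set κ := ∫ z : H × H,
      gram (z.1 - m) (z.2 - m) / ((‖z.1 - m‖ + 1) ^ 3 * (‖z.2 - m‖ + 1) ^ 3) ∂(μ.prod μ)
  have hgi : ∀ e : H, ‖e‖ = 1 →
      Integrable (fun x => gram (x - m) e / (‖x - m‖ + 1) ^ 3) μ := by
    intro e he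
    refine Integrable.of_bound (by
      unfold gram
      exact Measurable.aestronglyMeasurable (by fun_prop)) 1 (ae_of_all _ fun x => ?_)
    rw [Real.norm_eq_abs, abs_of_nonneg (div_nonneg (gram_nonneg _ _) (by positivity))]
    exact gram_div_le_one _ _ he
  -- A lower bound uniform in `e`: integrate `gram_div_div_le` over two independent points.
  have hκ : ∀ e : H, ‖e‖ = 1 → κ ≤ 4 * ∫ x, gram (x - m) e / (‖x - m‖ + 1) ^ 3 ∂μ := by
    intro e he
    have h1 : Integrable (fun z : H × H => gram (z.1 - m) e / (‖z.1 - m‖ + 1) ^ 3) (μ.prod μ) :=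
      (hgi e he).comp_fst μ
    have h2 : Integrable (fun z : H × H => gram (z.2 - m) e / (‖z.2 - m‖ + 1) ^ 3) (μ.prod μ) :=
      (hgi e he).comp_snd μ
    calc κ ≤ ∫ z : H × H, 2 * (gram (z.1 - m) e / (‖z.1 - m‖ + 1) ^ 3 +
          gram (z.2 - m) e / (‖z.2 - m‖ + 1) ^ 3) ∂(μ.prod μ) :=
          integral_mono hint ((h1.add h2).const_mul 2) fun z => gram_div_div_le _ _ e he
      _ = _ := by
          rw [integral_const_mul, integral_add h1 h2,
            integral_fun_fst (μ := μ) (ν := μ) (fun x => gram (x - m) e / (‖x - m‖ + 1) ^ 3),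
            integral_fun_snd (μ := μ) (ν := μ) (fun x => gram (x - m) e / (‖x - m‖ + 1) ^ 3)]
          simp
          ring
  have hsmall : ∀ (e : H) (r : ℝ), ‖e‖ = 1 → 0 ≤ r → r ≤ 1 →
      κ / 24 * r ^ 2 ≤ ∫ x, (‖x - (m + r • e)‖ - ‖x - m‖) ∂μ := by
    intro e r he hr0 hr1
    have i1 := integrable_norm_sub_sub μ (m + r • e) m
    have i2 := integrable_norm_sub_sub μ (m + (1 / 2 : ℝ) • r • e) m
    have h := integral_mono (μ := μ) ((hgi e he).const_mul (r ^ 2 / 12))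
      ((i1.div_const 2).sub i2) fun x => by
        have := norm_smul_gap x m (r • e) rfl e r hr0 hr1 he rfl
        refine this.trans_eq ?_
        simp only [Pi.sub_apply]
        ring
    rw [integral_const_mul] at h
    have h2 : ∫ x, ((fun x => (‖x - (m + r • e)‖ - ‖x - m‖) / 2) -
        fun x => ‖x - (m + (1 / 2 : ℝ) • r • e)‖ - ‖x - m‖) x ∂μ =
        (∫ x, (‖x - (m + r • e)‖ - ‖x - m‖) ∂μ) / 2 -
          ∫ x, (‖x - (m + (1 / 2 : ℝ) • r • e)‖ - ‖x - m‖) ∂μ := by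
      rw [← integral_div]
      exact integral_sub (i1.div_const 2) i2
    rw [h2] at h
    -- Minimality is used at the midpoint: its objective is not below that of `m`, so half the
    -- increase at the endpoint covers the whole gap.
    have h3 := hm (m + (1 / 2 : ℝ) • r • e)
    have h4 : r ^ 2 / 12 * (κ / 4) ≤
        r ^ 2 / 12 * ∫ x, gram (x - m) e / (‖x - m‖ + 1) ^ 3 ∂μ := by
      have := hκ e he
      gcongr
      linarith
    linarith
  refine ⟨κ / 24, by positivity, fun z => ?_⟩
  rcases eq_or_ne z m with rfl | hz
  · simp
  have hr0 : 0 < ‖z - m‖ := norm_pos_iff.2 (sub_ne_zero.2 hz)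
  set r := ‖z - m‖ with hr
  set e : H := r⁻¹ • (z - m) with he_def
  have he : ‖e‖ = 1 := by
    rw [he_def, norm_smul, norm_inv, Real.norm_eq_abs, abs_of_pos hr0, ← hr, inv_mul_cancel₀ hr0.ne']
  have hze : z = m + r • e := by
    rw [he_def, smul_smul, mul_inv_cancel₀ hr0.ne', one_smul]; abel
  rcases le_total r 1 with h1 | h1
  · have := hsmall e r he hr0.le h1
    rw [← hze] at this
    refine le_trans ?_ this
    gcongr
    exact min_le_right _ _
  · have h := hsmall e 1 he zero_le_one le_rfl
    -- Beyond distance `1`, convexity along the ray from `m` makes the growth at least linear, with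
    -- the slope reached at distance `1`.
    have hconv : ∫ x, (‖x - (m + (1 : ℝ) • e)‖ - ‖x - m‖) ∂μ ≤
        r⁻¹ * ∫ x, (‖x - z‖ - ‖x - m‖) ∂μ := by
      rw [← integral_const_mul]
      refine integral_mono (integrable_norm_sub_sub μ _ _)
        ((integrable_norm_sub_sub μ _ _).const_mul _) fun x => ?_
      have hdec : x - (m + (1 : ℝ) • e) = r⁻¹ • (x - z) + (1 - r⁻¹) • (x - m) := by
        rw [he_def]
        module
      have hri : r⁻¹ ≤ 1 := inv_le_one_of_one_le₀ h1
      have hri0 : 0 ≤ r⁻¹ := by positivity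
      have := norm_add_le (r⁻¹ • (x - z)) ((1 - r⁻¹) • (x - m))
      rw [← hdec, norm_smul, norm_smul, Real.norm_eq_abs, Real.norm_eq_abs, abs_of_nonneg hri0,
        abs_of_nonneg (by linarith : 0 ≤ 1 - r⁻¹)] at this
      linarith
    have h5 : κ / 24 ≤ r⁻¹ * ∫ x, (‖x - z‖ - ‖x - m‖) ∂μ := by linarith
    rw [inv_mul_eq_div, le_div_iff₀ hr0] at h5
    refine le_trans ?_ h5
    gcongr
    exact min_le_left _ _

end Analysis

/-! ### Independence and integration over the fresh sample -/

section Independence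

variable {Ω A B C : Type*} [MeasurableSpace Ω] {P : Measure Ω} [IsProbabilityMeasure P]
  [MeasurableSpace A] [MeasurableSpace B] [MeasurableSpace C]

/-- Both hypotheses factor the joint law into three marginals; reassociating the product regroups
them. Used with the starting point, the past samples and the next sample. -/
lemma indepFun_prodMk_left {f : Ω → A} {g : Ω → B} {h : Ω → C} (hf : Measurable f)
    (hg : Measurable g) (hh : Measurable h) (hfgh : IndepFun f (fun ω => (g ω, h ω)) P)
    (hgh : IndepFun g h P) : IndepFun (fun ω => (f ω, g ω)) h P := by
  have hfg : IndepFun f g P := hfgh.comp measurable_id measurable_fst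
  have e1 := hfgh.map_prod_eq_prod_map_map hf.aemeasurable (hg.prodMk hh).aemeasurable
  have e2 := hgh.map_prod_eq_prod_map_map hg.aemeasurable hh.aemeasurable
  have e3 := hfg.map_prod_eq_prod_map_map hf.aemeasurable hg.aemeasurable
  have := Measure.isProbabilityMeasure_map (μ := P) hf.aemeasurable
  have := Measure.isProbabilityMeasure_map (μ := P) hg.aemeasurable
  have := Measure.isProbabilityMeasure_map (μ := P) hh.aemeasurable
  rw [indepFun_iff_map_prod_eq_prod_map_map (hf.prodMk hg).aemeasurable hh.aemeasurable, e3]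
  have e4 : P.map (fun ω => ((f ω, g ω), h ω)) =
      (P.map fun ω => (f ω, (g ω, h ω))).map MeasurableEquiv.prodAssoc.symm := by
    rw [Measure.map_map (MeasurableEquiv.measurable _) (hf.prodMk (hg.prodMk hh))]
    rfl
  rw [e4, e1, e2, ← Measure.prodAssoc_prod, MeasurableEquiv.map_symm_map]

/-- Fubini for the product law. It plays the part of conditioning on the past: `f` is frozen and `g`
is integrated out. -/
lemma integral_comp_indepFun {f : Ω → A} {g : Ω → B} (hf : Measurable f) (hg : Measurable g)
    (h : IndepFun f g P) (F : A × B → ℝ) (hF : Measurable F)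
    (hint : Integrable (fun ω => F (f ω, g ω)) P) :
    Integrable (fun ω => ∫ y, F (f ω, y) ∂(P.map g)) P ∧
      ∫ ω, F (f ω, g ω) ∂P = ∫ ω, (∫ y, F (f ω, y) ∂(P.map g)) ∂P := by
  have e := h.map_prod_eq_prod_map_map hf.aemeasurable hg.aemeasurable
  have := Measure.isProbabilityMeasure_map (μ := P) hf.aemeasurable
  have := Measure.isProbabilityMeasure_map (μ := P) hg.aemeasurable
  have hi : Integrable F ((P.map f).prod (P.map g)) := by
    rw [← e, integrable_map_measure hF.aestronglyMeasurable (hf.prodMk hg).aemeasurable]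
    exact hint
  refine ⟨hi.integral_prod_left.comp_measurable hf, ?_⟩
  rw [← integral_map (f := F) (hf.prodMk hg).aemeasurable hF.aestronglyMeasurable, e,
    integral_prod F hi, integral_map hf.aemeasurable]
  exact hi.aestronglyMeasurable.integral_prod_right'

end Independence

/-! ### One step of the recursion, in mean square and in exponential moment -/

section Step

variable {Ω H : Type*} {F : MeasurableSpace Ω} {mΩ : MeasurableSpace Ω} {P : Measure Ω} [IsProbabilityMeasure P]
  [NormedAddCommGroup H] [MeasurableSpace H] [BorelSpace H] [TopologicalSpace.SeparableSpace H]
  {z z' Y : Ω → H} {w : Ω → ℝ} {m : H} {γ l R R' : ℝ}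

/-- One step of the recursion: mean decrease of the squared distance, weighted by a function of the
past. -/
lemma integral_sq_step (hF : F ≤ mΩ) (hz : Measurable[F] z) (hz' : Measurable z')
    (hY : Measurable Y) (hw : Measurable[F] w) (hw0 : ∀ ω, 0 ≤ w ω) (hw1 : ∀ ω, w ω ≤ 1)
    (hind : Indep F (MeasurableSpace.comap Y inferInstance) P)
    (hR : ∀ᵐ ω ∂P, ‖z ω - m‖ ≤ R) (hR' : ∀ᵐ ω ∂P, ‖z' ω - m‖ ≤ R')
    (hstep : ∀ ω, ‖z' ω - m‖ ^ 2 ≤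
      ‖z ω - m‖ ^ 2 - 2 * γ * (‖Y ω - z ω‖ - ‖Y ω - m‖) + γ ^ 2)
    (hγ : 0 ≤ γ)
    (hl : ∀ z : H, l * min ‖z - m‖ (‖z - m‖ ^ 2) ≤ ∫ x, (‖x - z‖ - ‖x - m‖) ∂(P.map Y)) :
    ∫ ω, w ω * ‖z' ω - m‖ ^ 2 ∂P + 2 * γ * l * ∫ ω, w ω * min ‖z ω - m‖ (‖z ω - m‖ ^ 2) ∂P ≤
      ∫ ω, w ω * ‖z ω - m‖ ^ 2 ∂P + γ ^ 2 := by
  have : SecondCountableTopology H := UniformSpace.secondCountable_of_separable H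
  have hzm : Measurable z := hz.mono hF le_rfl
  have hwm : Measurable w := hw.mono hF le_rfl
  have hwz : IndepFun (fun ω => (w ω, z ω)) Y P := by
    have hm : Measurable[F] (fun ω => (w ω, z ω)) := hw.prodMk hz
    exact indep_of_indep_of_le_left hind hm.comap_le
  have bd : ∀ {f : Ω → ℝ} {c : ℝ}, Measurable f → (∀ᵐ ω ∂P, |f ω| ≤ c) →
      Integrable (fun ω => w ω * f ω) P := by
    intro f c hf hc
    refine Integrable.of_bound (hwm.mul hf).aestronglyMeasurable c ?_
    filter_upwards [hc] with ω h
    rw [Real.norm_eq_abs, abs_mul, abs_of_nonneg (hw0 ω)]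
    exact (mul_le_of_le_one_left (abs_nonneg _) (hw1 ω)).trans h
  have i1 : Integrable (fun ω => w ω * ‖z' ω - m‖ ^ 2) P := by
    refine bd (c := R' ^ 2) (by fun_prop) ?_
    filter_upwards [hR'] with ω h
    rw [abs_of_nonneg (by positivity)]
    gcongr
  have i2 : Integrable (fun ω => w ω * ‖z ω - m‖ ^ 2) P := by
    refine bd (c := R ^ 2) (by fun_prop) ?_
    filter_upwards [hR] with ω h
    rw [abs_of_nonneg (by positivity)]
    gcongr
  have i3 : Integrable (fun ω => w ω * min ‖z ω - m‖ (‖z ω - m‖ ^ 2)) P := by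
    refine bd (c := R) (by fun_prop) ?_
    filter_upwards [hR] with ω h
    rw [abs_of_nonneg (by positivity)]
    exact (min_le_left _ _).trans h
  have i4 : Integrable (fun ω => w ω * (‖Y ω - z ω‖ - ‖Y ω - m‖)) P := by
    refine bd (c := R) (by fun_prop) ?_
    filter_upwards [hR] with ω h
    refine (abs_norm_sub_norm_le _ _).trans ?_
    rw [← norm_neg]
    convert! h using 2
    abel
  have i5 : Integrable w P := by
    simpa using bd (f := fun _ => 1) (c := 1) (by fun_prop) (by simp)
  obtain ⟨i6, hfub⟩ := integral_comp_indepFun (hwm.prodMk hzm) hY hwz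
    (fun q => q.1.1 * (‖q.2 - q.1.2‖ - ‖q.2 - m‖)) (by fun_prop) i4
  simp only [integral_const_mul] at hfub i6
  have hlow : l * ∫ ω, w ω * min ‖z ω - m‖ (‖z ω - m‖ ^ 2) ∂P ≤
      ∫ ω, w ω * (‖Y ω - z ω‖ - ‖Y ω - m‖) ∂P := by
    rw [hfub, ← integral_const_mul]
    refine integral_mono (i3.const_mul l) i6 fun ω => ?_
    have := mul_le_mul_of_nonneg_left (hl (z ω)) (hw0 ω)
    calc _ = w ω * (l * min ‖z ω - m‖ (‖z ω - m‖ ^ 2)) := by ring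
      _ ≤ _ := this
  have hw1' : ∫ ω, w ω ∂P ≤ 1 := by
    calc ∫ ω, w ω ∂P ≤ ∫ _, (1 : ℝ) ∂P := integral_mono i5 (integrable_const _) hw1
      _ = 1 := by simp
  have hmain : ∫ ω, w ω * ‖z' ω - m‖ ^ 2 ∂P ≤ ∫ ω, w ω * ‖z ω - m‖ ^ 2 ∂P -
      2 * γ * ∫ ω, w ω * (‖Y ω - z ω‖ - ‖Y ω - m‖) ∂P + γ ^ 2 * ∫ ω, w ω ∂P := by
    have i24 : Integrable (fun ω => w ω * ‖z ω - m‖ ^ 2 -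
        2 * γ * (w ω * (‖Y ω - z ω‖ - ‖Y ω - m‖))) P := i2.sub (i4.const_mul _)
    rw [← integral_const_mul, ← integral_const_mul, ← integral_sub i2 (i4.const_mul _),
      ← integral_add i24 (i5.const_mul _)]
    refine integral_mono i1 (i24.add (i5.const_mul _)) fun ω => ?_
    have := mul_le_mul_of_nonneg_left (hstep ω) (hw0 ω)
    refine this.trans_eq ?_
    ring
  have h1 : γ ^ 2 * ∫ ω, w ω ∂P ≤ γ ^ 2 := mul_le_of_le_one_right (sq_nonneg _) hw1'
  have h2 := mul_le_mul_of_nonneg_left hlow (by positivity : 0 ≤ 2 * γ)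
  linarith

lemma exp_le_one_add_add_sq {x : ℝ} (hx : |x| ≤ 1) : Real.exp x ≤ 1 + x + x ^ 2 := by
  have := (abs_le.1 (Real.abs_exp_sub_one_sub_id_le hx)).2
  linarith

-- Second-order expansion of the exponential. In the unit ball the drift is at least `t * l * ‖z -
-- m‖ ^ 2` and the second-order term at most `t ^ 2 * ‖z - m‖ ^ 2`; the condition `2 * t ≤ l` lets
-- half of the drift absorb the latter.
omit [TopologicalSpace.SeparableSpace H] in
lemma integral_exp_le (μ : Measure H) [IsProbabilityMeasure μ] [SecondCountableTopology H]
    (z : H) (hz : ‖z - m‖ ≤ 1) {t : ℝ} (ht0 : 0 ≤ t) (ht1 : t ≤ 1) (htl : 2 * t ≤ l)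
    (hl : l * min ‖z - m‖ (‖z - m‖ ^ 2) ≤ ∫ x, (‖x - z‖ - ‖x - m‖) ∂μ) :
    ∫ x, Real.exp (-(t * (‖x - z‖ - ‖x - m‖))) ∂μ ≤ Real.exp (-(t * l / 2 * ‖z - m‖ ^ 2)) := by
  have hD : ∀ x, |‖x - z‖ - ‖x - m‖| ≤ ‖z - m‖ := fun x => by
    refine (abs_norm_sub_norm_le _ _).trans_eq ?_
    rw [← norm_neg]
    congr 1
    abel
  have hmin : min ‖z - m‖ (‖z - m‖ ^ 2) = ‖z - m‖ ^ 2 :=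
    min_eq_right (by nlinarith [norm_nonneg (z - m)])
  rw [hmin] at hl
  have hi := integrable_norm_sub_sub μ z m
  have habs : ∀ x, |-(t * (‖x - z‖ - ‖x - m‖))| ≤ t * ‖z - m‖ := fun x => by
    rw [abs_neg, abs_mul, abs_of_nonneg ht0]
    exact mul_le_mul_of_nonneg_left (hD x) ht0
  have hle1 : t * ‖z - m‖ ≤ 1 := mul_le_one₀ ht1 (norm_nonneg _) hz
  have hie : Integrable (fun x => Real.exp (-(t * (‖x - z‖ - ‖x - m‖)))) μ := by
    refine Integrable.of_bound (by fun_prop) (Real.exp 1) (ae_of_all _ fun x => ?_)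
    rw [Real.norm_eq_abs, Real.abs_exp]
    exact Real.exp_le_exp.2 ((le_abs_self _).trans ((habs x).trans hle1))
  calc ∫ x, Real.exp (-(t * (‖x - z‖ - ‖x - m‖))) ∂μ
      ≤ ∫ x, ((1 + t ^ 2 * ‖z - m‖ ^ 2) - t * (‖x - z‖ - ‖x - m‖)) ∂μ := by
        refine integral_mono hie ((integrable_const _).sub (hi.const_mul t)) fun x => ?_
        have h1 := exp_le_one_add_add_sq ((habs x).trans hle1)
        have h2 : (-(t * (‖x - z‖ - ‖x - m‖))) ^ 2 ≤ (t * ‖z - m‖) ^ 2 := by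
          rw [← sq_abs]
          gcongr
          exact habs x
        dsimp only
        linarith [mul_pow t ‖z - m‖ 2]
    _ = 1 + t ^ 2 * ‖z - m‖ ^ 2 - t * ∫ x, (‖x - z‖ - ‖x - m‖) ∂μ := by
        rw [integral_sub (integrable_const _) (hi.const_mul t), integral_const_mul]
        simp
    _ ≤ 1 - t * l / 2 * ‖z - m‖ ^ 2 := by
        have h1 := mul_le_mul_of_nonneg_left hl ht0
        have h2 := mul_le_mul_of_nonneg_left htl (by positivity : 0 ≤ t * ‖z - m‖ ^ 2)
        nlinarith
    _ ≤ _ := by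
        have := Real.add_one_le_exp (-(t * l / 2 * ‖z - m‖ ^ 2))
        linarith

/-- One step of the recursion for the Gaussian weight `exp (S ‖z - m‖ ^ 2)` near `m`. -/
lemma integral_exp_step (hF : F ≤ mΩ) (hz : Measurable[F] z) (hz' : Measurable z')
    (hY : Measurable Y) (hw : Measurable[F] w) (hw0 : ∀ ω, 0 ≤ w ω) (hw1 : ∀ ω, w ω ≤ 1)
    (hws : ∀ ω, w ω ≠ 0 → ‖z ω - m‖ ≤ 1)
    (hind : Indep F (MeasurableSpace.comap Y inferInstance) P)
    (hR' : ∀ᵐ ω ∂P, ‖z' ω - m‖ ≤ R')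
    (hstep : ∀ ω, ‖z' ω - m‖ ^ 2 ≤
      ‖z ω - m‖ ^ 2 - 2 * γ * (‖Y ω - z ω‖ - ‖Y ω - m‖) + γ ^ 2)
    (hγ : 0 ≤ γ)
    (hl : ∀ z : H, l * min ‖z - m‖ (‖z - m‖ ^ 2) ≤ ∫ x, (‖x - z‖ - ‖x - m‖) ∂(P.map Y))
    {S : ℝ} (hS : 0 ≤ S) (hS1 : 2 * S * γ ≤ 1) (hSl : 4 * S * γ ≤ l) :
    ∫ ω, w ω * Real.exp (S * ‖z' ω - m‖ ^ 2) ∂P ≤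
      Real.exp (S * γ ^ 2) * ∫ ω, w ω * Real.exp (S * (1 - γ * l) * ‖z ω - m‖ ^ 2) ∂P := by
  have : SecondCountableTopology H := UniformSpace.secondCountable_of_separable H
  have hzm : Measurable z := hz.mono hF le_rfl
  have hwm : Measurable w := hw.mono hF le_rfl
  have := Measure.isProbabilityMeasure_map (μ := P) hY.aemeasurable
  have hwz : IndepFun (fun ω => (w ω, z ω)) Y P := by
    have hm : Measurable[F] (fun ω => (w ω, z ω)) := hw.prodMk hz
    exact indep_of_indep_of_le_left hind hm.comap_le
  have bd : ∀ {f : Ω → ℝ} (c : ℝ), Measurable f → (∀ᵐ ω ∂P, w ω ≠ 0 → f ω ≤ c) →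
      Integrable (fun ω => w ω * Real.exp (f ω)) P := by
    intro f c hf hc
    refine Integrable.of_bound (by fun_prop) (Real.exp c) ?_
    filter_upwards [hc] with ω h
    rw [Real.norm_eq_abs, abs_mul, abs_of_nonneg (hw0 ω), Real.abs_exp]
    by_cases hz0 : w ω = 0
    · rw [hz0, zero_mul]; positivity
    · exact (mul_le_of_le_one_left (by positivity) (hw1 ω)).trans (Real.exp_le_exp.2 (h hz0))
  have hD : ∀ ω, |‖Y ω - z ω‖ - ‖Y ω - m‖| ≤ ‖z ω - m‖ := fun ω => by
    refine (abs_norm_sub_norm_le _ _).trans_eq ?_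
    rw [← norm_neg]
    congr 1
    abel
  have hsq : ∀ ω, w ω ≠ 0 → ‖z ω - m‖ ^ 2 ≤ 1 := fun ω h => pow_le_one₀ (norm_nonneg _) (hws ω h)
  have i1 : Integrable (fun ω => w ω * Real.exp (S * ‖z' ω - m‖ ^ 2)) P := by
    refine bd (S * R' ^ 2) (by fun_prop) ?_
    filter_upwards [hR'] with ω h _
    gcongr
  have i2 : Integrable (fun ω => w ω * Real.exp (S * (1 - γ * l) * ‖z ω - m‖ ^ 2)) P := by
    refine bd |S * (1 - γ * l)| (by fun_prop) (ae_of_all _ fun ω h => ?_)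
    calc S * (1 - γ * l) * ‖z ω - m‖ ^ 2 ≤ |S * (1 - γ * l)| * ‖z ω - m‖ ^ 2 := by
          gcongr; exact le_abs_self _
      _ ≤ _ := mul_le_of_le_one_right (abs_nonneg _) (hsq ω h)
  have hexp : ∀ ω, Real.exp (S * ‖z ω - m‖ ^ 2) *
      Real.exp (-(2 * S * γ * (‖Y ω - z ω‖ - ‖Y ω - m‖))) =
      Real.exp (S * ‖z ω - m‖ ^ 2 - 2 * S * γ * (‖Y ω - z ω‖ - ‖Y ω - m‖)) := fun ω => by
    rw [← Real.exp_add]; congr 1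
  have i3 : Integrable (fun ω => w ω * (Real.exp (S * ‖z ω - m‖ ^ 2) *
      Real.exp (-(2 * S * γ * (‖Y ω - z ω‖ - ‖Y ω - m‖))))) P := by
    simp only [hexp]
    refine bd (S + 1) (by fun_prop) (ae_of_all _ fun ω h => ?_)
    have h1 := mul_le_mul_of_nonneg_left (hsq ω h) hS
    have h2 := (abs_le.1 ((hD ω).trans (hws ω h))).1
    have h3 := mul_le_mul_of_nonneg_left h2 (by positivity : 0 ≤ 2 * S * γ)
    linarith
  obtain ⟨i4, hfub⟩ := integral_comp_indepFun (hwm.prodMk hzm) hY hwz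
    (fun q => q.1.1 * (Real.exp (S * ‖q.1.2 - m‖ ^ 2) *
      Real.exp (-(2 * S * γ * (‖q.2 - q.1.2‖ - ‖q.2 - m‖))))) (by fun_prop) i3
  simp only [integral_const_mul] at hfub i4
  calc ∫ ω, w ω * Real.exp (S * ‖z' ω - m‖ ^ 2) ∂P
      ≤ ∫ ω, Real.exp (S * γ ^ 2) * (w ω * (Real.exp (S * ‖z ω - m‖ ^ 2) *
          Real.exp (-(2 * S * γ * (‖Y ω - z ω‖ - ‖Y ω - m‖))))) ∂P := by
        refine integral_mono i1 (i3.const_mul _) fun ω => ?_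
        have h1 := mul_le_mul_of_nonneg_left (hstep ω) hS
        calc w ω * Real.exp (S * ‖z' ω - m‖ ^ 2)
            ≤ w ω * Real.exp (S * γ ^ 2 +
              (S * ‖z ω - m‖ ^ 2 - 2 * S * γ * (‖Y ω - z ω‖ - ‖Y ω - m‖))) := by
              refine mul_le_mul_of_nonneg_left (Real.exp_le_exp.2 ?_) (hw0 ω)
              linarith
          _ = _ := by rw [Real.exp_add, ← hexp]; ring
    _ = Real.exp (S * γ ^ 2) * ∫ ω, w ω * (Real.exp (S * ‖z ω - m‖ ^ 2) *
          Real.exp (-(2 * S * γ * (‖Y ω - z ω‖ - ‖Y ω - m‖)))) ∂P := integral_const_mul _ _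
    _ ≤ _ := by
        refine mul_le_mul_of_nonneg_left ?_ (Real.exp_pos _).le
        rw [hfub]
        refine integral_mono i4 i2 fun ω => ?_
        by_cases h0 : w ω = 0
        · simp [h0]
        · refine mul_le_mul_of_nonneg_left ?_ (hw0 ω)
          -- The cross term of the squared recursion, scaled by `S`, has coefficient `t = 2 * S *
          -- γ`; the gain `t * l / 2 = S * γ * l` turns `S` into `S * (1 - γ * l)`.
          have := integral_exp_le (P.map Y) (z ω) (hws ω h0) (t := 2 * S * γ) (by positivity)
            hS1 (by linarith) (hl (z ω))
          calc _ ≤ Real.exp (S * ‖z ω - m‖ ^ 2) *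
                Real.exp (-(2 * S * γ * l / 2 * ‖z ω - m‖ ^ 2)) := by gcongr
            _ = _ := by rw [← Real.exp_add]; congr 1; ring

end Step

open Filter Topology

/-- Since `1 - t ≤ exp (-t)`, the product of the factors is at most `exp (-∑ t)`, which tends to
`0`. The initial value enters as `max (u K) 0` because `u` may be negative. -/
lemma eventually_le_one_of_contraction {u t : ℕ → ℝ} {K : ℕ} (ht0 : ∀ k, K ≤ k → 0 ≤ t k)
    (ht1 : ∀ k, K ≤ k → t k ≤ 1) (hu : ∀ k, K ≤ k → u (k + 1) ≤ (1 - t k) * u k)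
    (hsum : ¬ Summable t) : ∃ N, ∀ k, N ≤ k → u k ≤ 1 := by
  have hsum' : ¬ Summable fun j => t (j + K) := fun h => hsum ((summable_nat_add_iff K).1 h)
  have htend := (not_summable_iff_tendsto_nat_atTop_of_nonneg
    (fun j => ht0 (j + K) (Nat.le_add_left _ _))).1 hsum'
  have hbound : ∀ j, u (K + j) ≤ Real.exp (-∑ i ∈ Finset.range j, t (i + K)) * max (u K) 0 := by
    intro j
    induction j with
    | zero => simp
    | succ j ih =>
      have h1 := hu (K + j) (Nat.le_add_right _ _)
      have h2 := ht1 (K + j) (Nat.le_add_right _ _)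
      have h3 : 1 - t (K + j) ≤ Real.exp (-t (K + j)) := by
        have := Real.add_one_le_exp (-t (K + j)); linarith
      calc u (K + (j + 1)) ≤ (1 - t (K + j)) * u (K + j) := h1
        _ ≤ (1 - t (K + j)) * (Real.exp (-∑ i ∈ Finset.range j, t (i + K)) * max (u K) 0) :=
          mul_le_mul_of_nonneg_left ih (by linarith)
        _ ≤ Real.exp (-t (K + j)) *
            (Real.exp (-∑ i ∈ Finset.range j, t (i + K)) * max (u K) 0) := by gcongr
        _ = _ := by
          rw [← mul_assoc, ← Real.exp_add, Finset.sum_range_succ, add_comm j K]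
          congr 2
          ring
  have hlim : Tendsto (fun j => Real.exp (-∑ i ∈ Finset.range j, t (i + K)) * max (u K) 0)
      atTop (𝓝 (0 * max (u K) 0)) :=
    (Real.tendsto_exp_neg_atTop_nhds_zero.comp htend).mul_const _
  rw [zero_mul] at hlim
  obtain ⟨N, hN⟩ := eventually_atTop.1 (hlim.eventually_le_const (zero_lt_one' ℝ))
  refine ⟨K + N, fun k hk => ?_⟩
  obtain ⟨j, rfl⟩ := Nat.exists_eq_add_of_le (le_trans (Nat.le_add_right K N) hk)
  exact (hbound j).trans (hN j (by omega))

lemma measurable_indicator_one {Ω : Type*} {F : MeasurableSpace Ω} {s : Set Ω}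
    (hs : MeasurableSet[F] s) : Measurable[F] (s.indicator (1 : Ω → ℝ)) := by
  refine Measurable.indicator ?_ hs
  exact measurable_const

/-! ### Localization in the unit ball -/

section Sequence

variable {Ω H : Type*} [mΩ : MeasurableSpace Ω]
  [NormedAddCommGroup H] [MeasurableSpace H]

/-- The properties of the Robbins-Monro sequence `Z` used in the analysis: it is adapted to `ℱ`, its
increments are driven by the variables `Y n`, and the mean decrease is governed by `l`. -/
structure IsMedianRecursion (P : Measure Ω) (ℱ : ℕ → MeasurableSpace Ω) (Y Z : ℕ → Ω → H)
    (γ : ℕ → ℝ) (m : H) (l : ℝ) : Prop where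
  le : ∀ n, 1 ≤ n → ℱ n ≤ mΩ
  mono : ∀ n, 1 ≤ n → ℱ n ≤ ℱ (n + 1)
  adapted : ∀ n, 1 ≤ n → Measurable[ℱ n] (Z n)
  measurable_noise : ∀ n, 1 ≤ n → Measurable (Y n)
  indep : ∀ n, 1 ≤ n → Indep (ℱ n) (MeasurableSpace.comap (Y n) inferInstance) P
  bounded : ∀ n, 1 ≤ n → ∃ R : ℝ, ∀ᵐ ω ∂P, ‖Z n ω - m‖ ≤ R
  step : ∀ n, 1 ≤ n → ∀ ω, ‖Z (n + 1) ω - m‖ ^ 2 ≤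
    ‖Z n ω - m‖ ^ 2 - 2 * γ n * (‖Y n ω - Z n ω‖ - ‖Y n ω - m‖) + γ n ^ 2
  step_nonneg : ∀ n, 0 ≤ γ n
  growth : ∀ n, 1 ≤ n → ∀ z : H,
    l * min ‖z - m‖ (‖z - m‖ ^ 2) ≤ ∫ x, (‖x - z‖ - ‖x - m‖) ∂(P.map (Y n))
  growth_pos : 0 < l

variable {P : Measure Ω} [IsProbabilityMeasure P] {ℱ : ℕ → MeasurableSpace Ω}
  {Y Z : ℕ → Ω → H} {γ : ℕ → ℝ} {m : H} {l : ℝ}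

namespace IsMedianRecursion

omit [IsProbabilityMeasure P] in
lemma measurable (h : IsMedianRecursion P ℱ Y Z γ m l) {n : ℕ} (hn : 1 ≤ n) : Measurable (Z n) :=
  (h.adapted n hn).mono (h.le n hn) le_rfl

omit [IsProbabilityMeasure P] in
lemma mono_of_le (h : IsMedianRecursion P ℱ Y Z γ m l) {j k : ℕ} (hj : 1 ≤ j) (hjk : j ≤ k) :
    ℱ j ≤ ℱ k := by
  induction k, hjk using Nat.le_induction with
  | base => exact le_rfl
  | succ k hk ih => exact ih.trans (h.mono k (hj.trans hk))

variable [BorelSpace H] [TopologicalSpace.SeparableSpace H]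

lemma sq_step (h : IsMedianRecursion P ℱ Y Z γ m l) {n : ℕ} (hn : 1 ≤ n) {w : Ω → ℝ}
    (hw : Measurable[ℱ n] w) (hw0 : ∀ ω, 0 ≤ w ω) (hw1 : ∀ ω, w ω ≤ 1) :
    ∫ ω, w ω * ‖Z (n + 1) ω - m‖ ^ 2 ∂P +
        2 * γ n * l * ∫ ω, w ω * min ‖Z n ω - m‖ (‖Z n ω - m‖ ^ 2) ∂P ≤
      ∫ ω, w ω * ‖Z n ω - m‖ ^ 2 ∂P + γ n ^ 2 := by
  obtain ⟨R, hR⟩ := h.bounded n hn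
  obtain ⟨R', hR'⟩ := h.bounded (n + 1) (by omega)
  exact integral_sq_step (h.le n hn) (h.adapted n hn) (h.measurable (by omega))
    (h.measurable_noise n hn) hw hw0 hw1 (h.indep n hn) hR hR' (h.step n hn) (h.step_nonneg n)
    (h.growth n hn)

/-- Otherwise the mean squared distance would lose at least `2 * l * ε * γ n` at each step, up to
the summable `γ n ^ 2`. As it stays nonnegative, telescoping would make `γ` summable. -/
lemma exists_integral_min_le (h : IsMedianRecursion P ℱ Y Z γ m l)
    (hγ2 : Summable fun n => γ n ^ 2) (hγ : ¬ Summable γ) {ε : ℝ} (hε : 0 < ε) (N : ℕ) :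
    ∃ n, N ≤ n ∧ 1 ≤ n ∧ ∫ ω, min ‖Z n ω - m‖ (‖Z n ω - m‖ ^ 2) ∂P ≤ ε := by
  by_contra! hcon
  apply hγ
  set K := max N 1
  have hK : ∀ j, N ≤ j + K ∧ 1 ≤ j + K := fun j => by
    have h1 : N ≤ K := le_max_left _ _
    have h2 : 1 ≤ K := le_max_right _ _
    omega
  have hl := h.growth_pos
  have hstep : ∀ j, ∫ ω, ‖Z (j + K + 1) ω - m‖ ^ 2 ∂P + 2 * l * ε * γ (j + K) ≤
      ∫ ω, ‖Z (j + K) ω - m‖ ^ 2 ∂P + γ (j + K) ^ 2 := by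
    intro j
    have h1 := h.sq_step (hK j).2 (w := fun _ => 1) measurable_const (by simp) (by simp)
    simp only [one_mul] at h1
    have h2 := (hcon (j + K) (hK j).1 (hK j).2).le
    have h3 := mul_le_mul_of_nonneg_left h2
      (by have := h.step_nonneg (j + K); positivity : 0 ≤ 2 * γ (j + K) * l)
    linarith
  have hsum : ∀ n, ∫ ω, ‖Z (n + K) ω - m‖ ^ 2 ∂P +
      2 * l * ε * ∑ j ∈ Finset.range n, γ (j + K) ≤
      ∫ ω, ‖Z K ω - m‖ ^ 2 ∂P + ∑ j ∈ Finset.range n, γ (j + K) ^ 2 := by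
    intro n
    induction n with
    | zero => simp
    | succ n ih =>
      have := hstep n
      rw [Finset.sum_range_succ, Finset.sum_range_succ, show n + 1 + K = n + K + 1 by ring]
      linarith
  have hγ2' : Summable fun j => γ (j + K) ^ 2 := (summable_nat_add_iff K).2 hγ2
  refine (summable_nat_add_iff K).1 (summable_of_sum_range_le (f := fun j => γ (j + K))
    (c := (∫ ω, ‖Z K ω - m‖ ^ 2 ∂P + ∑' j, γ (j + K) ^ 2) / (2 * l * ε))
    (fun j => h.step_nonneg _) fun n => ?_)
  rw [le_div_iff₀ (by positivity)]
  have h1 := hsum n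
  have h2 := hγ2'.sum_le_tsum (Finset.range n) (fun _ _ => sq_nonneg _)
  have h3 : 0 ≤ ∫ ω, ‖Z (n + K) ω - m‖ ^ 2 ∂P := integral_nonneg fun _ => sq_nonneg _
  linarith

omit [TopologicalSpace.SeparableSpace H] in
lemma integrable_sq (h : IsMedianRecursion P ℱ Y Z γ m l) {n : ℕ} (hn : 1 ≤ n) {s : Set Ω}
    (hs : MeasurableSet s) [SecondCountableTopology H] :
    Integrable (fun ω => s.indicator 1 ω * ‖Z n ω - m‖ ^ 2) P := by
  obtain ⟨R, hR⟩ := h.bounded n hn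
  have hm := h.measurable hn
  refine Integrable.of_bound (C := R ^ 2) (Measurable.aestronglyMeasurable
    ((measurable_indicator_one hs).mul (by fun_prop))) ?_
  filter_upwards [hR] with ω hω
  have h1 : ‖Z n ω - m‖ ^ 2 ≤ R ^ 2 := by gcongr
  by_cases hωs : ω ∈ s
  · simpa [hωs] using h1
  · simpa [hωs] using sq_nonneg R

/-- With high probability the sequence remains in the unit ball around `m` from some rank on. -/
lemma exists_local_events (h : IsMedianRecursion P ℱ Y Z γ m l)
    (hγ2 : Summable fun n => γ n ^ 2) (hγ : ¬ Summable γ) {ε : ℝ} (hε : 0 < ε) :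
    ∃ n₀, 1 ≤ n₀ ∧ ∃ A : ℕ → Set Ω, ∀ k, n₀ ≤ k → MeasurableSet[ℱ k] (A k) ∧ A (k + 1) ⊆ A k ∧
      (∀ ω ∈ A k, ‖Z k ω - m‖ ≤ 1) ∧ 1 - ε ≤ P.real (A k) := by
  have : SecondCountableTopology H := UniformSpace.secondCountable_of_separable H
  obtain ⟨η, hη0, hη1, hηε⟩ : ∃ η : ℝ, 0 < η ∧ η ≤ 1 ∧ η ^ 2 ≤ ε / 3 := by
    refine ⟨min 1 (ε / 3), by positivity, min_le_left _ _, ?_⟩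
    have h1 : min 1 (ε / 3) ≤ 1 := min_le_left _ _
    have h2 : min 1 (ε / 3) ≤ ε / 3 := min_le_right _ _
    have h3 : 0 < min 1 (ε / 3) := by positivity
    nlinarith
  obtain ⟨N, hN⟩ := eventually_atTop.1
    ((tendsto_sum_nat_add fun n => γ n ^ 2).eventually_le_const (by positivity : 0 < ε / 3))
  -- The budget `ε` is split in three: Markov at time `n₀`, the squared radius `η ^ 2` of the
  -- starting ball, and the tail of `∑ γ ^ 2`.
  obtain ⟨n₀, hn₀N, hn₀, hmin⟩ := h.exists_integral_min_le hγ2 hγ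
    (by positivity : 0 < η ^ 2 * (ε / 3)) N
  set A : ℕ → Set Ω := fun k =>
    {ω | ‖Z n₀ ω - m‖ ≤ η} ∩ ⋂ j ∈ Finset.Icc n₀ k, {ω | ‖Z j ω - m‖ ≤ 1} with hA
  have hAF : ∀ k, n₀ ≤ k → MeasurableSet[ℱ k] (A k) := by
    intro k hk
    have hball : ∀ j, n₀ ≤ j → j ≤ k → ∀ a : ℝ, MeasurableSet[ℱ k] {ω | ‖Z j ω - m‖ ≤ a} := by
      intro j hj hjk a
      have hZ : Measurable[ℱ k] (Z j) :=
        (h.adapted j (hn₀.trans hj)).mono (h.mono_of_le (hn₀.trans hj) hjk) le_rfl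
      exact hZ (measurableSet_le (by fun_prop) measurable_const :
        MeasurableSet {x : H | ‖x - m‖ ≤ a})
    refine MeasurableSet.inter (hball n₀ le_rfl hk η) ?_
    refine Finset.measurableSet_biInter _ fun j hj => ?_
    rw [Finset.mem_Icc] at hj
    exact hball j hj.1 hj.2 1
  have hAm : ∀ k, n₀ ≤ k → MeasurableSet (A k) := fun k hk => h.le k (hn₀.trans hk) _ (hAF k hk)
  have hAle : ∀ k, n₀ ≤ k → ∀ ω ∈ A k, ‖Z k ω - m‖ ≤ 1 := by
    intro k hk ω hω
    have := hω.2
    simp only [Finset.mem_Icc, Set.mem_iInter, Set.mem_ofPred_eq] at this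
    exact this k ⟨hk, le_rfl⟩
  have hAsub : ∀ k, A (k + 1) ⊆ A k := by
    intro k
    refine Set.inter_subset_inter_right _ (Set.biInter_mono (fun j hj => ?_) fun _ _ => le_rfl)
    simp only [Finset.coe_Icc, Set.mem_Icc] at hj ⊢
    omega
  have hAexit : ∀ k, n₀ ≤ k → ∀ ω ∈ A k, ω ∉ A (k + 1) → 1 ≤ ‖Z (k + 1) ω - m‖ ^ 2 := by
    intro k hk ω hω hω'
    by_contra! hlt
    apply hω'
    refine ⟨hω.1, ?_⟩
    have h2 := hω.2
    simp only [Finset.mem_Icc, Set.mem_iInter, Set.mem_ofPred_eq] at h2 ⊢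
    intro j hj
    rcases Nat.lt_or_ge j (k + 1) with h3 | h3
    · exact h2 j ⟨hj.1, by omega⟩
    · obtain rfl : j = k + 1 := by omega
      nlinarith [norm_nonneg (Z (k + 1) ω - m)]
  have hAn₀ : A n₀ = {ω | ‖Z n₀ ω - m‖ ≤ η} := by
    ext ω
    simp only [hA, Finset.Icc_self, Finset.mem_singleton, Set.iInter_iInter_eq_left,
      Set.mem_inter_iff, Set.mem_ofPred_eq, and_iff_left_iff_imp]
    exact fun h => h.trans hη1
  have hPA : ∀ k, n₀ ≤ k → ∫ ω, (A k).indicator (1 : Ω → ℝ) ω ∂P = P.real (A k) := fun k hk =>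
    integral_indicator_one (hAm k hk)
  have hPi : ∀ k, n₀ ≤ k → Integrable ((A k).indicator (1 : Ω → ℝ)) P := fun k hk =>
    (integrable_const (1 : ℝ)).indicator (hAm k hk)
  -- A maximal inequality: on leaving the unit ball the squared distance is at least `1`, so the
  -- exit probability `P.real (A n₀) - P.real (A (n₀ + j))` is paid for by the squared distance lost
  -- from the integral.
  have hind : ∀ j, ∫ ω, (A (n₀ + j)).indicator 1 ω * ‖Z (n₀ + j) ω - m‖ ^ 2 ∂P + P.real (A n₀) ≤
      η ^ 2 + ∑ i ∈ Finset.range j, γ (i + n₀) ^ 2 + P.real (A (n₀ + j)) := by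
    intro j
    induction j with
    | zero =>
      simp only [add_zero, Finset.range_zero, Finset.sum_empty]
      gcongr
      calc ∫ ω, (A n₀).indicator 1 ω * ‖Z n₀ ω - m‖ ^ 2 ∂P ≤ ∫ _, η ^ 2 ∂P := by
            refine integral_mono (h.integrable_sq hn₀ (hAm n₀ le_rfl)) (integrable_const _)
              fun ω => ?_
            by_cases hω : ω ∈ A n₀
            · have : ‖Z n₀ ω - m‖ ≤ η := by rw [hAn₀] at hω; exact hω
              simp only [hω, Set.indicator_of_mem, Pi.one_apply, one_mul]
              gcongr
            · simpa [hω] using sq_nonneg η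
        _ = η ^ 2 := by simp
    | succ j ih =>
      have hk : n₀ ≤ n₀ + j := Nat.le_add_right _ _
      have hk1 : n₀ ≤ n₀ + j + 1 := by omega
      have hs := h.sq_step (hn₀.trans hk) (w := (A (n₀ + j)).indicator 1)
        (measurable_indicator_one (hAF _ hk))
        (fun ω => Set.indicator_nonneg (fun _ _ => zero_le_one) ω)
        (fun ω => Set.indicator_le_self' (fun _ _ => zero_le_one) ω)
      have hm0 : 0 ≤ ∫ ω, (A (n₀ + j)).indicator 1 ω *
          min ‖Z (n₀ + j) ω - m‖ (‖Z (n₀ + j) ω - m‖ ^ 2) ∂P :=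
        integral_nonneg fun ω => mul_nonneg
          (Set.indicator_nonneg (fun _ _ => zero_le_one) ω) (by positivity)
      have hm1 : 0 ≤ 2 * γ (n₀ + j) * l := by
        have := h.step_nonneg (n₀ + j)
        have := h.growth_pos
        positivity
      have hm2 := mul_nonneg hm1 hm0
      have i1 := h.integrable_sq (hn₀.trans hk1) (hAm _ hk1)
      have i2 := h.integrable_sq (hn₀.trans hk1) (hAm _ hk)
      have hpt : ∫ ω, (A (n₀ + j + 1)).indicator 1 ω * ‖Z (n₀ + j + 1) ω - m‖ ^ 2 ∂P +
          P.real (A (n₀ + j)) ≤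
          ∫ ω, (A (n₀ + j)).indicator 1 ω * ‖Z (n₀ + j + 1) ω - m‖ ^ 2 ∂P +
            P.real (A (n₀ + j + 1)) := by
        rw [← hPA _ hk, ← hPA _ hk1, ← integral_add i1 (hPi _ hk), ← integral_add i2 (hPi _ hk1)]
        refine integral_mono (i1.add (hPi _ hk)) (i2.add (hPi _ hk1)) fun ω => ?_
        by_cases hω : ω ∈ A (n₀ + j)
        · by_cases hω' : ω ∈ A (n₀ + j + 1)
          · simp [hω, hω']
          · simpa [hω, hω'] using hAexit _ hk ω hω hω'
        · have hω' : ω ∉ A (n₀ + j + 1) := fun hh => hω (hAsub _ hh)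
          simp [hω, hω']
      rw [Finset.sum_range_succ, add_comm j n₀, ← add_assoc]
      linarith
  refine ⟨n₀, hn₀, A, fun k hk => ⟨hAF k hk, hAsub k, hAle k hk, ?_⟩⟩
  obtain ⟨j, rfl⟩ := Nat.exists_eq_add_of_le hk
  have h1 := hind j
  have h2 : ∑ i ∈ Finset.range j, γ (i + n₀) ^ 2 ≤ ε / 3 :=
    (((summable_nat_add_iff n₀).2 hγ2).sum_le_tsum _ fun _ _ => sq_nonneg _).trans (hN n₀ hn₀N)
  have h3 : 0 ≤ ∫ ω, (A (n₀ + j)).indicator 1 ω * ‖Z (n₀ + j) ω - m‖ ^ 2 ∂P :=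
    integral_nonneg fun ω => mul_nonneg
      (Set.indicator_nonneg (fun _ _ => zero_le_one) ω) (by positivity)
  have h4 : 1 - ε / 3 ≤ P.real (A n₀) := by
    have hc : P.real (A n₀)ᶜ ≤ ε / 3 := by
      have hsub : (A n₀)ᶜ ⊆ {ω | η ^ 2 ≤ min ‖Z n₀ ω - m‖ (‖Z n₀ ω - m‖ ^ 2)} := by
        intro ω hω
        rw [hAn₀] at hω
        have hω' : η < ‖Z n₀ ω - m‖ := not_le.1 hω
        have : η ^ 2 ≤ ‖Z n₀ ω - m‖ ^ 2 := by gcongr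
        exact le_min (by nlinarith) this
      have hmi : Integrable (fun ω => min ‖Z n₀ ω - m‖ (‖Z n₀ ω - m‖ ^ 2)) P := by
        obtain ⟨R, hR⟩ := h.bounded n₀ hn₀
        have hm := h.measurable hn₀
        refine Integrable.of_bound (by fun_prop) R ?_
        filter_upwards [hR] with ω hω
        rw [Real.norm_eq_abs, abs_of_nonneg (by positivity)]
        exact (min_le_left _ _).trans hω
      have hmk := mul_meas_ge_le_integral_of_nonneg
        (ae_of_all P fun ω => by positivity) hmi (η ^ 2)
      have hle := (mul_le_mul_of_nonneg_left (measureReal_mono hsub)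
        (sq_nonneg η)).trans (hmk.trans hmin)
      exact le_of_mul_le_mul_left hle (by positivity)
    rw [probReal_compl_eq_one_sub (hAm n₀ le_rfl)] at hc
    linarith
  linarith

end IsMedianRecursion

end Sequence

/-! ### Exponential moments and confidence balls -/

lemma exp_one_sub_mul_le {θ x : ℝ} (h0 : 0 ≤ θ) (h1 : θ ≤ 1) :
    Real.exp ((1 - θ) * x) ≤ (1 - θ) * Real.exp x + θ := by
  have := convexOn_exp.2 (Set.mem_univ x) (Set.mem_univ 0) (sub_nonneg.2 h1) h0 (by ring)
  simpa using this

lemma succ_rpow_le {α : ℝ} (h1 : α ≤ 1) {k : ℕ} (hk : 1 ≤ k) :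
    ((k + 1 : ℕ) : ℝ) ^ α ≤ (k : ℝ) ^ α * (1 + (k : ℝ)⁻¹) := by
  have hk0 : (0 : ℝ) < k := by exact_mod_cast hk
  have e : ((k + 1 : ℕ) : ℝ) = k * (1 + (k : ℝ)⁻¹) := by push_cast; field_simp
  rw [e, Real.mul_rpow hk0.le (by positivity)]
  gcongr
  have hle : (1 : ℝ) ≤ 1 + (k : ℝ)⁻¹ := by
    have : 0 ≤ (k : ℝ)⁻¹ := by positivity
    linarith
  calc _ ≤ (1 + (k : ℝ)⁻¹) ^ (1 : ℝ) := Real.rpow_le_rpow_of_exponent_le hle h1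
    _ = _ := Real.rpow_one _

namespace IsMedianRecursion

variable {Ω H : Type*} [mΩ : MeasurableSpace Ω]
  [NormedAddCommGroup H] [MeasurableSpace H] [BorelSpace H] [TopologicalSpace.SeparableSpace H]
  {P : Measure Ω} [IsProbabilityMeasure P] {ℱ : ℕ → MeasurableSpace Ω}
  {Y Z : ℕ → Ω → H} {m : H} {l c α : ℝ}

omit [TopologicalSpace.SeparableSpace H] in
lemma integrable_exp {γ : ℕ → ℝ} [SecondCountableTopology H]
    (h : IsMedianRecursion P ℱ Y Z γ m l) {n : ℕ} (hn : 1 ≤ n)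
    {s : Set Ω} (hs : MeasurableSet s) {S : ℝ} (hS : 0 ≤ S) :
    Integrable (fun ω => s.indicator 1 ω * Real.exp (S * ‖Z n ω - m‖ ^ 2)) P := by
  obtain ⟨R, hR⟩ := h.bounded n hn
  have hm := h.measurable hn
  refine Integrable.of_bound (C := Real.exp (S * R ^ 2)) (Measurable.aestronglyMeasurable
    ((measurable_indicator_one hs).mul (by fun_prop))) ?_
  filter_upwards [hR] with ω hω
  have h1 : Real.exp (S * ‖Z n ω - m‖ ^ 2) ≤ Real.exp (S * R ^ 2) := by gcongr
  by_cases hωs : ω ∈ s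
  · simpa [hωs] using h1
  · simpa [hωs] using (Real.exp_pos _).le

/-- The Gaussian exponential moments of the rescaled error contract, on events where the sequence is
close to `m`. -/
lemma exp_moment_step (h : IsMedianRecursion P ℱ Y Z (fun k : ℕ => c * (k : ℝ) ^ (-α)) m l)
    (hc : 0 < c) (hα1 : α ≤ 1) {s : ℝ} (hs : 0 < s) (hs1 : 4 * s * c ≤ 1)
    (hsl : 16 * s * c ≤ l) {k : ℕ} (hk : 1 ≤ k) (hkl : c * (k : ℝ) ^ (-α) * l ≤ 1)
    (hkα : (k : ℝ)⁻¹ ≤ c * (k : ℝ) ^ (-α) * l / 2) {A A' : Set Ω} (hA : MeasurableSet[ℱ k] A)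
    (hA' : MeasurableSet A') (hAA' : A' ⊆ A) (hA1 : ∀ ω ∈ A, ‖Z k ω - m‖ ≤ 1) :
    ∫ ω, A'.indicator 1 ω *
        Real.exp (s * ((k + 1 : ℕ) : ℝ) ^ α * ‖Z (k + 1) ω - m‖ ^ 2) ∂P - 4 ≤
      (1 - c * (k : ℝ) ^ (-α) * l / 4) *
        (∫ ω, A.indicator 1 ω * Real.exp (s * (k : ℝ) ^ α * ‖Z k ω - m‖ ^ 2) ∂P - 4) := by
  have : SecondCountableTopology H := UniformSpace.secondCountable_of_separable H
  have hk0 : (0 : ℝ) < k := by exact_mod_cast hk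
  obtain ⟨γ, hγ⟩ : ∃ γ, γ = c * (k : ℝ) ^ (-α) := ⟨_, rfl⟩
  have hγ0 : 0 < γ := by rw [hγ]; positivity
  have hγk : (k : ℝ) ^ α * γ = c := by
    rw [hγ, mul_left_comm, ← Real.rpow_add hk0]; simp
  have hl := h.growth_pos
  have hAm : MeasurableSet A := h.le k hk _ hA
  obtain ⟨S, hSdef⟩ : ∃ S, S = s * ((k + 1 : ℕ) : ℝ) ^ α := ⟨_, rfl⟩
  have hS0 : 0 ≤ S := by rw [hSdef]; positivity
  have hkinv : (k : ℝ)⁻¹ ≤ 1 := inv_le_one_of_one_le₀ (by exact_mod_cast hk)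
  have hSle : S ≤ s * (k : ℝ) ^ α * (1 + (k : ℝ)⁻¹) := by
    rw [hSdef, mul_assoc]
    exact mul_le_mul_of_nonneg_left (succ_rpow_le hα1 hk) hs.le
  have hSγ : S * γ ≤ 2 * s * c := by
    have : S ≤ s * (k : ℝ) ^ α * 2 := hSle.trans (by gcongr; linarith)
    calc S * γ ≤ s * (k : ℝ) ^ α * 2 * γ := by gcongr
      _ = 2 * s * ((k : ℝ) ^ α * γ) := by ring
      _ = _ := by rw [hγk]
  have hw0 : ∀ (B : Set Ω) ω, (0 : ℝ) ≤ B.indicator 1 ω := fun B ω =>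
    Set.indicator_nonneg (fun _ _ => zero_le_one) ω
  have hw1 : ∀ (B : Set Ω) ω, B.indicator 1 ω ≤ (1 : ℝ) := fun B ω =>
    Set.indicator_le_self' (fun _ _ => zero_le_one) ω
  rw [← hγ] at hkl hkα ⊢
  rw [← hSdef]
  obtain ⟨R', hR'⟩ := h.bounded (k + 1) (by omega)
  have hstep := integral_exp_step (γ := γ) (h.le k hk) (h.adapted k hk)
    (h.measurable (by omega : 1 ≤ k + 1)) (h.measurable_noise k hk)
    (measurable_indicator_one hA) (hw0 A) (hw1 A)
    (fun ω hω => hA1 ω (by by_contra hn; exact hω (Set.indicator_of_notMem hn _)))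
    (h.indep k hk) hR' (by rw [hγ]; exact h.step k hk) hγ0.le (h.growth k hk) hS0
    (by linarith) (by linarith)
  set Q := ∫ ω, A.indicator 1 ω * Real.exp (s * (k : ℝ) ^ α * ‖Z k ω - m‖ ^ 2) ∂P with hQ
  obtain ⟨θ, hθ⟩ : ∃ θ, θ = γ * l / 2 := ⟨_, rfl⟩
  have hθ0 : 0 < θ := by rw [hθ]; positivity
  have hθ1 : θ ≤ 1 / 2 := by rw [hθ]; linarith
  have hiQ := h.integrable_exp hk hAm (S := s * (k : ℝ) ^ α) (by positivity)
  have hiA : Integrable (A.indicator (1 : Ω → ℝ)) P := (integrable_const (1 : ℝ)).indicator hAm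
  have hint1 : ∫ ω, A'.indicator 1 ω * Real.exp (S * ‖Z (k + 1) ω - m‖ ^ 2) ∂P ≤
      ∫ ω, A.indicator 1 ω * Real.exp (S * ‖Z (k + 1) ω - m‖ ^ 2) ∂P := by
    refine integral_mono (h.integrable_exp (by omega) hA' hS0) (h.integrable_exp (by omega) hAm hS0)
      fun ω => ?_
    refine mul_le_mul_of_nonneg_right ?_ (Real.exp_pos _).le
    exact Set.indicator_le_indicator_of_subset hAA' (fun _ => zero_le_one) ω
  -- Passing from `k ^ α` to `(k + 1) ^ α` costs a factor `1 + 1 / k`, and `1 / k ≤ θ`; half of the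
  -- drift `γ * l = 2 * θ` remains.
  have hcoef : S * (1 - γ * l) ≤ s * (k : ℝ) ^ α * (1 - θ) := by
    have hx : (0 : ℝ) ≤ (k : ℝ)⁻¹ := by positivity
    calc S * (1 - γ * l) ≤ s * (k : ℝ) ^ α * (1 + (k : ℝ)⁻¹) * (1 - γ * l) :=
          mul_le_mul_of_nonneg_right hSle (by linarith)
      _ = s * (k : ℝ) ^ α * ((1 + (k : ℝ)⁻¹) * (1 - γ * l)) := by ring
      _ ≤ s * (k : ℝ) ^ α * (1 - θ) := by
          refine mul_le_mul_of_nonneg_left ?_ (by positivity)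
          have : 0 ≤ (k : ℝ)⁻¹ * (γ * l) := by positivity
          nlinarith
  have hint2 : ∫ ω, A.indicator 1 ω * Real.exp (S * (1 - γ * l) * ‖Z k ω - m‖ ^ 2) ∂P ≤
      (1 - θ) * Q + θ := by
    calc _ ≤ ∫ ω, ((1 - θ) * (A.indicator 1 ω * Real.exp (s * (k : ℝ) ^ α * ‖Z k ω - m‖ ^ 2)) +
          θ * A.indicator 1 ω) ∂P := by
          refine integral_mono (h.integrable_exp hk hAm (mul_nonneg hS0 (by linarith)))
            ((hiQ.const_mul _).add (hiA.const_mul θ)) fun ω => ?_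
          have h1 : Real.exp (S * (1 - γ * l) * ‖Z k ω - m‖ ^ 2) ≤
              Real.exp ((1 - θ) * (s * (k : ℝ) ^ α * ‖Z k ω - m‖ ^ 2)) := by
            refine Real.exp_le_exp.2 ?_
            calc _ ≤ s * (k : ℝ) ^ α * (1 - θ) * ‖Z k ω - m‖ ^ 2 := by gcongr
              _ = _ := by ring
          have h2 := mul_le_mul_of_nonneg_left
            (h1.trans (exp_one_sub_mul_le hθ0.le (by linarith))) (hw0 A ω)
          refine h2.trans_eq ?_
          ring
      _ = (1 - θ) * Q + θ * P.real A := by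
          rw [integral_add (hiQ.const_mul _) (hiA.const_mul θ), integral_const_mul,
            integral_const_mul, integral_indicator_one hAm]
      _ ≤ _ := by
          have := mul_le_of_le_one_right hθ0.le (measureReal_le_one (μ := P) (s := A))
          linarith
  have hexp : Real.exp (S * γ ^ 2) ≤ 1 + θ / 2 := by
    have h1 : S * γ ^ 2 ≤ θ / 4 := by
      calc S * γ ^ 2 = S * γ * γ := by ring
        _ ≤ 2 * s * c * γ := by gcongr
        _ ≤ l / 8 * γ := by gcongr; linarith
        _ = θ / 4 := by rw [hθ]; ring
    have h2 := exp_le_one_add_add_sq (x := θ / 4) (by rw [abs_of_nonneg] <;> linarith)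
    have := Real.exp_le_exp.2 h1
    nlinarith
  have hQ0 : 0 ≤ Q := integral_nonneg fun ω => mul_nonneg (hw0 A ω) (Real.exp_pos _).le
  have hfin : ∫ ω, A'.indicator 1 ω * Real.exp (S * ‖Z (k + 1) ω - m‖ ^ 2) ∂P ≤
      (1 + θ / 2) * ((1 - θ) * Q + θ) := by
    refine hint1.trans (hstep.trans ?_)
    refine mul_le_mul hexp hint2 ?_ (by linarith)
    exact integral_nonneg fun ω => mul_nonneg (hw0 A ω) (Real.exp_pos _).le
  have e1 : γ * l / 4 = θ / 2 := by rw [hθ]; ring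
  rw [e1]
  -- The map `Q ↦ (1 + θ / 2) * ((1 - θ) * Q + θ)` has linear factor at most `1 - θ / 2` and
  -- constant term `θ + θ ^ 2 / 2`. Centring at `4` leaves room `2 * θ` for the latter.
  nlinarith [mul_nonneg (sq_nonneg θ) hQ0]

/-- Non-asymptotic confidence balls for a recursion with steps `c * n ^ (-α)`. -/
theorem confidence_ball (h : IsMedianRecursion P ℱ Y Z (fun k : ℕ => c * (k : ℝ) ^ (-α)) m l)
    (hc : 0 < c) (hα : 1 / 2 < α) (hα' : α < 1) :
    ∃ C : ℝ, 0 < C ∧ ∀ δ : ℝ, 0 < δ → δ < 1 → ∃ N : ℕ, ∀ n : ℕ, N ≤ n →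
      1 - δ ≤ P.real {ω | ‖Z n ω - m‖ ≤ C * (n : ℝ) ^ (-(α / 2)) * Real.log (4 / δ)} := by
  have : SecondCountableTopology H := UniformSpace.secondCountable_of_separable H
  have hl := h.growth_pos
  obtain ⟨s, hs, hs1, hsl⟩ : ∃ s : ℝ, 0 < s ∧ 4 * s * c ≤ 1 ∧ 16 * s * c ≤ l := by
    refine ⟨min (1 / 4) (l / 16) / c, by positivity, ?_, ?_⟩
    · have : min (1 / 4) (l / 16) ≤ 1 / 4 := min_le_left _ _
      rw [mul_assoc, div_mul_cancel₀ _ hc.ne']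
      linarith
    · have : min (1 / 4) (l / 16) ≤ l / 16 := min_le_right _ _
      rw [mul_assoc, div_mul_cancel₀ _ hc.ne']
      linarith
  have hγ2 : Summable fun n : ℕ => (c * (n : ℝ) ^ (-α)) ^ 2 := by
    have : Summable fun n : ℕ => c ^ 2 * (n : ℝ) ^ (-α * 2) :=
      (Real.summable_nat_rpow.2 (by linarith)).mul_left _
    refine this.congr fun n => ?_
    rw [mul_pow, Real.rpow_mul (Nat.cast_nonneg n), Real.rpow_two]
  have hγ : ∀ a : ℝ, a ≠ 0 → ¬ Summable fun n : ℕ => a * (n : ℝ) ^ (-α) := fun a ha hsum => by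
    have := Real.summable_nat_rpow.1 ((summable_mul_left_iff ha).1 hsum)
    linarith
  -- The second condition holds eventually because `α < 1`: the steps decay more slowly than `1 /
  -- k`.
  have hev : ∀ᶠ k : ℕ in atTop, c * (k : ℝ) ^ (-α) * l ≤ 1 ∧
      (k : ℝ)⁻¹ ≤ c * (k : ℝ) ^ (-α) * l / 2 := by
    have t1 : Tendsto (fun k : ℕ => c * (k : ℝ) ^ (-α) * l) atTop (𝓝 (c * 0 * l)) :=
      (((tendsto_rpow_neg_atTop (by linarith : 0 < α)).comp
        tendsto_natCast_atTop_atTop).const_mul c).mul_const l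
    have t2 : Tendsto (fun k : ℕ => (k : ℝ) ^ (1 - α)) atTop atTop :=
      (tendsto_rpow_atTop (by linarith)).comp tendsto_natCast_atTop_atTop
    filter_upwards [t1.eventually_le_const (by simp : c * 0 * l < 1),
      t2.eventually_ge_atTop (2 / (c * l)), eventually_ge_atTop 1] with k h1 h2 hk
    refine ⟨h1, ?_⟩
    have hk0 : (0 : ℝ) < k := by exact_mod_cast hk
    have e : (k : ℝ) ^ (-α) = (k : ℝ) ^ (1 - α) * (k : ℝ)⁻¹ := by
      rw [← Real.rpow_neg_one, ← Real.rpow_add hk0]; congr 1; ring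
    rw [div_le_iff₀ (by positivity)] at h2
    rw [e]
    have h3 : (1 : ℝ) ≤ c * (k : ℝ) ^ (1 - α) * l / 2 := by nlinarith
    calc (k : ℝ)⁻¹ = 1 * (k : ℝ)⁻¹ := (one_mul _).symm
      _ ≤ c * (k : ℝ) ^ (1 - α) * l / 2 * (k : ℝ)⁻¹ := by gcongr
      _ = _ := by ring
  obtain ⟨K, hK⟩ := eventually_atTop.1 hev
  -- Chosen so that outside the ball the exponent `s * n ^ α * ‖Z n - m‖ ^ 2` is at least `2 * L ^
  -- 2`, hence at least `2 * L` because `L ≥ 1`. The moment is eventually at most `5`, so Markov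
  -- gives `5 * δ ^ 2 / 16 ≤ δ / 2`; the other `δ / 2` covers the complement of `A n`.
  refine ⟨√(2 / s), by positivity, fun δ hδ hδ1 => ?_⟩
  obtain ⟨n₀, hn₀, A, hA⟩ := h.exists_local_events hγ2 (hγ c hc.ne') (half_pos hδ)
  have hAm : ∀ k, n₀ ≤ k → MeasurableSet (A k) := fun k hk => h.le k (hn₀.trans hk) _ (hA k hk).1
  obtain ⟨N, hN⟩ := eventually_le_one_of_contraction (K := max K n₀)
    (u := fun k => ∫ ω, (A k).indicator 1 ω *
      Real.exp (s * (k : ℝ) ^ α * ‖Z k ω - m‖ ^ 2) ∂P - 4)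
    (t := fun k : ℕ => c * (k : ℝ) ^ (-α) * l / 4)
    (fun k _ => by positivity)
    (fun k hk => by linarith [(hK k (le_trans (le_max_left _ _) hk)).1])
    (fun k hk => by
      have hk1 := le_trans (le_max_left _ _) hk
      have hk2 := le_trans (le_max_right _ _) hk
      exact h.exp_moment_step hc hα'.le hs hs1 hsl (hn₀.trans hk2) (hK k hk1).1
        (hK k hk1).2 (hA k hk2).1 (hAm _ (by omega)) (hA k hk2).2.1 (hA k hk2).2.2.1)
    (by
      have := hγ (c * l / 4) (by positivity)
      convert! this using 3
      ring)
  refine ⟨max N n₀, fun n hn => ?_⟩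
  have hnN := le_trans (le_max_left _ _) hn
  have hn0 := le_trans (le_max_right _ _) hn
  have hn1 : 1 ≤ n := hn₀.trans hn0
  have hnpos : (0 : ℝ) < n := by exact_mod_cast hn1
  have hZ := h.measurable hn1
  set L := Real.log (4 / δ) with hL
  have hL1 : 1 ≤ L := by
    rw [hL, Real.le_log_iff_exp_le (by positivity)]
    have h1 := Real.exp_one_lt_d9
    have h2 : 4 ≤ 4 / δ := by rw [le_div_iff₀ hδ]; linarith
    linarith
  set G := {ω | ‖Z n ω - m‖ ≤ √(2 / s) * (n : ℝ) ^ (-(α / 2)) * L} with hG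
  have hGm : MeasurableSet G := measurableSet_le (by fun_prop) measurable_const
  have hi := h.integrable_exp hn1 (hAm n hn0) (S := s * (n : ℝ) ^ α) (by positivity)
  have hQ := hN n hnN
  have hsub : Gᶜ ⊆ (A n)ᶜ ∪ {ω | Real.exp (2 * L) ≤
      (A n).indicator 1 ω * Real.exp (s * (n : ℝ) ^ α * ‖Z n ω - m‖ ^ 2)} := by
    intro ω hω
    by_cases hωA : ω ∈ A n
    · right
      have hlt : √(2 / s) * (n : ℝ) ^ (-(α / 2)) * L < ‖Z n ω - m‖ := not_le.1 hω
      have hsq : (√(2 / s) * (n : ℝ) ^ (-(α / 2)) * L) ^ 2 ≤ ‖Z n ω - m‖ ^ 2 := by gcongr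
      have e : s * (n : ℝ) ^ α * (√(2 / s) * (n : ℝ) ^ (-(α / 2)) * L) ^ 2 = 2 * L ^ 2 := by
        rw [mul_pow, mul_pow, Real.sq_sqrt (by positivity), ← Real.rpow_two,
          ← Real.rpow_mul hnpos.le,
          show s * (n : ℝ) ^ α * (2 / s * (n : ℝ) ^ (-(α / 2) * 2) * L ^ 2) =
            s * (2 / s) * ((n : ℝ) ^ α * (n : ℝ) ^ (-(α / 2) * 2)) * L ^ 2 by ring,
          ← Real.rpow_add hnpos, mul_div_cancel₀ _ hs.ne']
        ring_nf
        simp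
      have h1 := mul_le_mul_of_nonneg_left hsq (by positivity : 0 ≤ s * (n : ℝ) ^ α)
      rw [e] at h1
      simp only [Set.mem_ofPred_eq, hωA, Set.indicator_of_mem, Pi.one_apply, one_mul]
      exact Real.exp_le_exp.2 (by nlinarith)
    · exact Or.inl hωA
  have hmk := mul_meas_ge_le_integral_of_nonneg (ae_of_all P fun ω => mul_nonneg
    (Set.indicator_nonneg (fun _ _ => zero_le_one) ω) (Real.exp_pos _).le) hi (Real.exp (2 * L))
  have hexpL : Real.exp (2 * L) = (4 / δ) ^ 2 := by
    rw [two_mul, Real.exp_add, hL, Real.exp_log (by positivity)]; ring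
  have hp2 : P.real {ω | Real.exp (2 * L) ≤
      (A n).indicator 1 ω * Real.exp (s * (n : ℝ) ^ α * ‖Z n ω - m‖ ^ 2)} ≤ δ / 2 := by
    have h5 := hmk.trans (sub_le_iff_le_add.1 hQ)
    norm_num only at h5
    rw [hexpL] at h5 ⊢
    rw [← le_div_iff₀' (by positivity)] at h5
    refine h5.trans ?_
    rw [div_pow, div_div_eq_mul_div]
    nlinarith
  have hp1 : P.real (A n)ᶜ ≤ δ / 2 := by
    rw [probReal_compl_eq_one_sub (hAm n hn0)]
    linarith [(hA n hn0).2.2.2]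
  have hp : P.real Gᶜ ≤ δ := by
    refine (measureReal_mono hsub).trans ((measureReal_union_le _ _).trans ?_)
    linarith
  rw [probReal_compl_eq_one_sub hGm] at hp
  linarith

end IsMedianRecursion

/-! ### The Robbins-Monro sequence fits the abstract recursion -/

section Recursion

variable {Ω H : Type*} [NormedAddCommGroup H] [InnerProductSpace ℝ H]

lemma robbinsMonro_succ (γ : ℕ → ℝ) (Xs : ℕ → Ω → H) (Z₁ : Ω → H) {n : ℕ} (hn : 1 ≤ n) (ω : Ω) :
    robbinsMonro γ Xs Z₁ (n + 1) ω = robbinsMonro γ Xs Z₁ n ω +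
      γ n • (‖Xs (n + 1) ω - robbinsMonro γ Xs Z₁ n ω‖⁻¹ •
        (Xs (n + 1) ω - robbinsMonro γ Xs Z₁ n ω)) := by
  obtain ⟨k, rfl⟩ := Nat.exists_eq_add_of_le' hn
  rfl

lemma norm_inv_norm_smul_le (v : H) : ‖‖v‖⁻¹ • v‖ ≤ 1 := by
  rw [norm_smul, norm_inv, norm_norm]
  exact inv_mul_le_one

/-- The direction `u` satisfies `⟨x - z, u⟩ = ‖x - z‖` (also when `x = z`) and `⟨x - m, u⟩ ≤ ‖x -
m‖`; subtracting bounds the cross term `⟨z - m, u⟩`. -/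
lemma norm_add_smul_sub_sq_le (z x m : H) {γ : ℝ} (hγ : 0 ≤ γ) :
    ‖z + γ • (‖x - z‖⁻¹ • (x - z)) - m‖ ^ 2 ≤
      ‖z - m‖ ^ 2 - 2 * γ * (‖x - z‖ - ‖x - m‖) + γ ^ 2 := by
  set u := ‖x - z‖⁻¹ • (x - z) with hu
  have hu1 : ‖u‖ ≤ 1 := norm_inv_norm_smul_le _
  have hux : inner ℝ (x - z) u = ‖x - z‖ := by
    rw [hu, inner_smul_right, real_inner_self_eq_norm_sq]
    by_cases h0 : ‖x - z‖ = 0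
    · simp [h0]
    · field_simp
  have hum : inner ℝ (x - m) u ≤ ‖x - m‖ :=
    (real_inner_le_norm _ _).trans (mul_le_of_le_one_right (norm_nonneg _) hu1)
  have hsplit : inner ℝ (z - m) u = inner ℝ (x - m) u - inner ℝ (x - z) u := by
    rw [← inner_sub_left]; congr 1; abel
  have e : z + γ • u - m = (z - m) + γ • u := by abel
  rw [e, norm_add_sq_real, inner_smul_right, norm_smul, mul_pow, Real.norm_eq_abs, sq_abs, hsplit,
    hux]
  have h1 := mul_le_mul_of_nonneg_left hum hγ
  have h2 : γ ^ 2 * ‖u‖ ^ 2 ≤ γ ^ 2 :=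
    mul_le_of_le_one_right (sq_nonneg _) (pow_le_one₀ (norm_nonneg _) hu1)
  linarith

variable [MeasurableSpace Ω] {P : Measure Ω} [MeasurableSpace H]

/-- The `σ`-algebra generated by `Z₁` and `X₂, …, X_n`. -/
abbrev history (Xs : ℕ → Ω → H) (Z₁ : Ω → H) (n : ℕ) : MeasurableSpace Ω :=
  MeasurableSpace.comap (fun ω => (Z₁ ω, fun i : Finset.Ico 1 n => Xs (i + 1) ω)) inferInstance

variable {Xs : ℕ → Ω → H} {Z₁ : Ω → H}

omit [InnerProductSpace ℝ H] [NormedAddCommGroup H] [MeasurableSpace Ω] in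
lemma measurable_history_start (n : ℕ) : Measurable[history Xs Z₁ n] Z₁ := by
  have : Measurable[history Xs Z₁ n]
      (fun ω => (Z₁ ω, fun i : Finset.Ico 1 n => Xs (i + 1) ω)) := comap_measurable _
  exact measurable_fst.comp this

omit [InnerProductSpace ℝ H] [NormedAddCommGroup H] [MeasurableSpace Ω] in
lemma measurable_history_sample {n i : ℕ} (hi : 1 ≤ i) (hin : i < n) :
    Measurable[history Xs Z₁ n] (Xs (i + 1)) := by
  have : Measurable[history Xs Z₁ n]
      (fun ω => (Z₁ ω, fun i : Finset.Ico 1 n => Xs (i + 1) ω)) := comap_measurable _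
  exact (measurable_pi_apply (⟨i, Finset.mem_Ico.2 ⟨hi, hin⟩⟩ : Finset.Ico 1 n)).comp
    (measurable_snd.comp this)

omit [InnerProductSpace ℝ H] [NormedAddCommGroup H] [MeasurableSpace Ω] in
lemma history_le {F : MeasurableSpace Ω} (n : ℕ) (h1 : Measurable[F] Z₁)
    (h2 : ∀ i, 1 ≤ i → i < n → Measurable[F] (Xs (i + 1))) : history Xs Z₁ n ≤ F := by
  refine Measurable.comap_le (h1.prodMk (measurable_pi_lambda _ fun i => ?_))
  exact h2 i (Finset.mem_Ico.1 i.2).1 (Finset.mem_Ico.1 i.2).2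

omit [InnerProductSpace ℝ H] [NormedAddCommGroup H] in
lemma indep_history [IsProbabilityMeasure P] (hXs : ∀ n, 1 ≤ n → Measurable (Xs n))
    (hindep : iIndepFun (fun n : ℕ => Xs (n + 1)) P) (hZ₁ : Measurable Z₁)
    (hZ₁indep : IndepFun Z₁ (fun ω (n : ℕ) => Xs (n + 2) ω) P) {n : ℕ} (hn : 1 ≤ n) :
    Indep (history Xs Z₁ n) (MeasurableSpace.comap (Xs (n + 1)) inferInstance) P := by
  have hm : ∀ i : ℕ, Measurable (Xs (i + 1)) := fun i => hXs _ (by omega)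
  have h1 := hindep.indepFun_finset (Finset.Ico 1 n) {n} (by simp) hm
  have h2 : IndepFun (fun ω (i : Finset.Ico 1 n) => Xs (i + 1) ω) (Xs (n + 1)) P :=
    h1.comp measurable_id
      (measurable_pi_apply (⟨n, Finset.mem_singleton_self n⟩ : ({n} : Finset ℕ)))
  refine indepFun_prodMk_left hZ₁ (measurable_pi_lambda _ fun i => hm i) (hm n) ?_ h2
  -- Coordinate `j` of the sequence in `hZ₁indep` is `Xs (j + 2)`, so `Xs (i + 1)` sits at `i - 1`;
  -- the truncated subtraction is exact because `i ≥ 1`.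
  have hφ : Measurable fun f : ℕ → H =>
      ((fun i : Finset.Ico 1 n => f (i - 1)), f (n - 1)) := by fun_prop
  have h3 := hZ₁indep.comp measurable_id hφ
  convert! h3 using 2 with ω
  ext i
  · have := (Finset.mem_Ico.1 i.2).1
    simp only [Function.comp]
    congr 1
    omega
  · simp only [Function.comp]
    rw [show n - 1 + 2 = n + 1 by omega]

omit [MeasurableSpace Ω] in
lemma measurable_history_robbinsMonro [BorelSpace H] [SecondCountableTopology H] (γ : ℕ → ℝ)
    {n : ℕ} (hn : 1 ≤ n) : Measurable[history Xs Z₁ n] (robbinsMonro γ Xs Z₁ n) := by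
  induction n, hn using Nat.le_induction with
  | base => exact measurable_history_start 1
  | succ n hn ih =>
    have hle : history Xs Z₁ n ≤ history Xs Z₁ (n + 1) :=
      history_le n (measurable_history_start _) fun i hi hin =>
        measurable_history_sample hi (by omega)
    have hZ : Measurable[history Xs Z₁ (n + 1)] (robbinsMonro γ Xs Z₁ n) := ih.mono hle le_rfl
    have hX : Measurable[history Xs Z₁ (n + 1)] (Xs (n + 1)) :=
      measurable_history_sample hn (by omega)
    have hg : Measurable fun q : H × H => q.1 + γ n • (‖q.2 - q.1‖⁻¹ • (q.2 - q.1)) := by fun_prop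
    have e : robbinsMonro γ Xs Z₁ (n + 1) = fun ω => (fun q : H × H =>
        q.1 + γ n • (‖q.2 - q.1‖⁻¹ • (q.2 - q.1))) (robbinsMonro γ Xs Z₁ n ω, Xs (n + 1) ω) :=
      funext fun ω => robbinsMonro_succ γ Xs Z₁ hn ω
    rw [e]
    exact hg.comp (hZ.prodMk hX)

omit [MeasurableSpace H] in
lemma robbinsMonro_bounded {γ : ℕ → ℝ} (m : H) (hbdd : ∃ M : ℝ, ∀ᵐ ω ∂P, ‖Z₁ ω‖ ≤ M)
    (hγ : ∀ n, 0 ≤ γ n) {n : ℕ} (hn : 1 ≤ n) :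
    ∃ R : ℝ, ∀ᵐ ω ∂P, ‖robbinsMonro γ Xs Z₁ n ω - m‖ ≤ R := by
  induction n, hn using Nat.le_induction with
  | base =>
    obtain ⟨M, hM⟩ := hbdd
    refine ⟨M + ‖m‖, ?_⟩
    filter_upwards [hM] with ω h
    exact (norm_sub_le _ _).trans (by simpa [robbinsMonro] using h)
  | succ n hn ih =>
    obtain ⟨R, hR⟩ := ih
    refine ⟨R + γ n, ?_⟩
    filter_upwards [hR] with ω h
    rw [robbinsMonro_succ γ Xs Z₁ hn, add_sub_right_comm]
    refine (norm_add_le _ _).trans (add_le_add h ?_)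
    rw [norm_smul, Real.norm_eq_abs, abs_of_nonneg (hγ n)]
    exact mul_le_of_le_one_right (hγ n) (norm_inv_norm_smul_le _)

lemma NotOnLine.not_ae_const [BorelSpace H] [SecondCountableTopology H] [IsProbabilityMeasure P]
    {X : Ω → H} (h : NotOnLine X P) (hX : Measurable X) (v : H) :
    ∃ h' : H, inner ℝ v h' = 0 ∧ ∀ a : ℝ, ¬ ∀ᵐ x ∂(P.map X), inner ℝ h' x = a := by
  obtain ⟨h', hor, hvar⟩ := h v
  refine ⟨h', hor, fun a ha => hvar.ne' ?_⟩
  have ha' : ∀ᵐ ω ∂P, inner ℝ h' (X ω) = a := ae_of_ae_map hX.aemeasurable ha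
  have hae : AEMeasurable (fun ω => inner ℝ h' (X ω)) P := by fun_prop
  rw [evariance_eq_zero_iff hae]
  have hmean : ∫ ω, inner ℝ h' (X ω) ∂P = a := by
    rw [integral_congr_ae ha']; simp
  filter_upwards [ha'] with ω h
  rw [h, hmean]

omit [InnerProductSpace ℝ H] in
lemma IsMedian.integral_nonneg [BorelSpace H] [SecondCountableTopology H] [IsProbabilityMeasure P]
    {X : Ω → H} {m : H} (h : IsMedian X P m) (hX : Measurable X) (z : H) :
    0 ≤ ∫ x, (‖x - z‖ - ‖x - m‖) ∂(P.map X) := by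
  have := Measure.isProbabilityMeasure_map (μ := P) hX.aemeasurable
  have hobj : ∀ v : H, objective X P v = ∫ x, (‖x - v‖ - ‖x - 0‖) ∂(P.map X) := fun v => by
    rw [integral_map hX.aemeasurable (by fun_prop)]
    simp [objective]
  have h1 := h z
  rw [hobj, hobj, ← sub_nonneg, ← integral_sub (integrable_norm_sub_sub _ _ _)
    (integrable_norm_sub_sub _ _ _)] at h1
  simpa using h1

end Recursion

end GeometricMedian

theorem theorem4p1 {Ω H : Type*} [MeasurableSpace Ω] (P : Measure Ω) [IsProbabilityMeasure P]
    [NormedAddCommGroup H] [InnerProductSpace ℝ H] [CompleteSpace H]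
    [TopologicalSpace.SeparableSpace H] [MeasurableSpace H] [BorelSpace H]
    -- the random variable `X` and its geometric median `m`
    (X : Ω → H) (hX : Measurable X)
    (hA1 : GeometricMedian.NotOnLine X P)
    (hA2 : GeometricMedian.BoundedInverseMoment 1 X P)
    (hA3 : GeometricMedian.BoundedInverseMoment 2 X P)
    (m : H) (hm : GeometricMedian.IsMedian X P m)
    -- independent copies `X_1, X_2, ...` of `X`
    (Xs : ℕ → Ω → H) (hXs : ∀ n, 1 ≤ n → Measurable (Xs n))
    (hindep : iIndepFun (fun n : ℕ => Xs (n + 1)) P)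
    (hident : ∀ n, 1 ≤ n → IdentDistrib (Xs n) X P P)
    -- bounded starting point, independent of `X_2, X_3, ...`
    (Z₁ : Ω → H) (hZ₁ : Measurable Z₁)
    (hbdd : ∃ M : ℝ, ∀ᵐ ω ∂P, ‖Z₁ ω‖ ≤ M)
    (hZ₁indep : IndepFun Z₁ (fun ω (n : ℕ) => Xs (n + 2) ω) P)
    -- step sizes `γ_n = c n ^ (-α)`
    (c α : ℝ) (hc : 0 < c) (hα : 1 / 2 < α) (hα' : α < 1) :
    ∃ C : ℝ, 0 < C ∧ ∀ δ : ℝ, 0 < δ → δ < 1 → ∃ N : ℕ, ∀ n : ℕ, N ≤ n →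
      1 - δ ≤ P.real {ω |
        ‖GeometricMedian.robbinsMonro (fun k : ℕ => c * (k : ℝ) ^ (-α)) Xs Z₁ n ω - m‖
          ≤ C * (n : ℝ) ^ (-(α / 2)) * Real.log (4 / δ)} := by
  have : SecondCountableTopology H := UniformSpace.secondCountable_of_separable H
  have := Measure.isProbabilityMeasure_map (μ := P) hX.aemeasurable
  obtain ⟨l, hl, hgrowth⟩ := GeometricMedian.exists_growth (P.map X) m
    (hA1.not_ae_const hX) (hm.integral_nonneg hX)
  have hrec : GeometricMedian.IsMedianRecursion P (GeometricMedian.history Xs Z₁)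
      (fun n => Xs (n + 1))
      (GeometricMedian.robbinsMonro (fun k : ℕ => c * (k : ℝ) ^ (-α)) Xs Z₁)
      (fun k : ℕ => c * (k : ℝ) ^ (-α)) m l :=
    { le := fun n _ => GeometricMedian.history_le n hZ₁ fun i _ _ => hXs _ (by omega)
      mono := fun n _ => GeometricMedian.history_le n
        (GeometricMedian.measurable_history_start _) fun i hi hin =>
          GeometricMedian.measurable_history_sample hi (by omega)
      adapted := fun n hn => GeometricMedian.measurable_history_robbinsMonro _ hn
      measurable_noise := fun n _ => hXs _ (by omega)
      indep := fun n hn => GeometricMedian.indep_history hXs hindep hZ₁ hZ₁indep hn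
      bounded := fun n hn =>
        GeometricMedian.robbinsMonro_bounded m hbdd (fun k => by positivity) hn
      step := fun n hn ω => by
        rw [GeometricMedian.robbinsMonro_succ _ Xs Z₁ hn]
        exact GeometricMedian.norm_add_smul_sub_sq_le _ _ m (by positivity)
      step_nonneg := fun n => by positivity
      growth := fun n _ => by
        rw [(hident (n + 1) (by omega)).map_eq]
        exact hgrowth
      growth_pos := hl }
  exact hrec.confidence_ball hc hα hα'
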